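/- **Setting.** Let $a(n)\ge 0$ $(n\ge 1)$ be a sequence of real numbers, and put $\mathcal A(x)=\sum_{n\le x}a(n)$ and $\mathcal A(x;q,b)=\sum_{n\le x,\ n\equiv b\,(\mathrm{mod}\ q)}a(n)$. Let $\mathcal S$ be a finite set of primes, and let $h$ be a multiplicative function with $0\le h(n)\le 1$ for all $n$; write $(q,\mathcal S)=1$ when no prime in $\mathcal S$ divides $q$. For $q\ge 1$ put $$\gamma_q=\prod_{p\mid q}\Big(\frac{1-h(p)/p}{1-1/p}\Big)^{-1},$$ and let $f_q$ be the multiplicative function with $f_q(p^k)=1$ if $p\nmid q$ and, if $p^e$ $(e\ge1)$ is the exact power of $p$ dividing $q$, $$f_q(p^k)=\begin{cases}\big(h(p^k)-h(p^{k+1})/p\big)\big(1-h(p)/p\big)^{-1}& k<e,\\ h(p^e)\,(1-1/p)\,\big(1-h(p)/p\big)^{-1}& k\ge e,\end{cases}$$ so that $f_q(b)=f_q((b,q))$; this defines $f_q$ on residue classes mod $q$. If $\mathcal A(x)>0$, define $$\Delta_q=\Delta_q(x)=\sup_{x/4\le y\le x}\ \max_{b\,(\mathrm{mod}\ q)}\Big|\mathcal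 A(y;q,b)-\frac{f_q(b)}{q\gamma_q}\frac yx\mathcal A(x)\Big|\Big/\frac{\mathcal A(x)}{\phi(q)}.$$ **Theorem 2.4.** There are absolute constants $C>0$ and $X$ such that the following holds for all $x\ge X$, all sequences $a$ with $\mathcal A(x)>0$, and all $\mathcal S$, $h$ as above with $\mathcal S\subset[1,\log\log x]$. Let $$\frac1{100}>\eta\ge\frac{20\log\log\log x}{\log\log x},$$ and let $(\log x)^\eta\le z\le(\log x)/3$ be such that $$\sum_{z^{1-\eta}\le p\le z}\frac{1-h(p)}p\ \ge\ \eta\log\big((1-\eta)^{-1}\big),$$ the sum being over primes $p$. Then for every real $u$ with $5/\eta^2\le u\le\sqrt z$, $$\max_{\substack{1\le \ell\le x/z^u\\(\ell,\mathcal S)=1}}\Delta_\ell(x)\ \ge\ C\exp\big(-u(1+25\eta)\log(2u/\eta^2)\big).$$ -/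

import Mathlib

namespace ArithSeq

noncomputable section

/-- The summatory function `𝒜(x) = ∑_{1 ≤ n ≤ x} a(n)`. -/
def total (a : ℕ → ℝ) (x : ℝ) : ℝ :=
  ∑ n ∈ Finset.Icc 1 ⌊x⌋₊, a n

/-- `𝒜(x; q, b) = ∑_{1 ≤ n ≤ x, n ≡ b (mod q)} a(n)`. -/
def totalAP (a : ℕ → ℝ) (x : ℝ) (q b : ℕ) : ℝ :=
  ∑ n ∈ (Finset.Icc 1 ⌊x⌋₊).filter (fun n => n ≡ b [MOD q]), a n

/-- The value `f_q(p^k)` for a prime `p ∣ q`, where `p^e` is the exact power of `p` dividing `q`. -/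
def localFactor (h : ℕ → ℝ) (p e k : ℕ) : ℝ :=
  if k < e then (h (p ^ k) - h (p ^ (k + 1)) / p) * (1 - h p / p)⁻¹
  else h (p ^ e) * (1 - 1 / (p : ℝ)) * (1 - h p / p)⁻¹

/-- The multiplicative function `f_q`, evaluated at a residue class `b (mod q)` through
`f_q(b) = f_q((b, q))` (so that `f_q(0) = f_q(q)`).  Primes not dividing `q` contribute `1`. -/
def fq (h : ℕ → ℝ) (q b : ℕ) : ℝ :=
  ∏ p ∈ q.primeFactors, localFactor h p (q.factorization p) ((Nat.gcd b q).factorization p)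

/-- `γ_q = ∏_{p ∣ q} ((1 - h(p)/p) / (1 - 1/p))⁻¹`. -/
def gammaq (h : ℕ → ℝ) (q : ℕ) : ℝ :=
  ∏ p ∈ q.primeFactors, ((1 - h p / p) / (1 - 1 / (p : ℝ)))⁻¹

/-- The normalised error
`|𝒜(y; q, b) - f_q(b)/(q γ_q) · (y/x) 𝒜(x)| / (𝒜(x)/φ(q))`. -/
def discrepancyAt (a h : ℕ → ℝ) (x : ℝ) (q : ℕ) (y : ℝ) (b : ℕ) : ℝ :=
  |totalAP a y q b - fq h q b / (q * gammaq h q) * (y / x) * total a x| /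
    (total a x / (Nat.totient q : ℝ))

/-- The values of the normalised error for `x/4 ≤ y ≤ x` and residue classes `b (mod q)`. -/
def discrepancySet (a h : ℕ → ℝ) (x : ℝ) (q : ℕ) : Set ℝ :=
  {r | ∃ y ∈ Set.Icc (x / 4) x, ∃ b : ℕ, r = discrepancyAt a h x q y b}

/-- `Δ_q(x)`: the largest normalised error (a supremum, since `y` is a real variable). -/
def Delta (a h : ℕ → ℝ) (x : ℝ) (q : ℕ) : ℝ :=
  sSup (discrepancySet a h x q)

/-- On positive integers `n`, `f_q(n) = ∏_{p ∣ q} f_q(p^{v_p(n)})`. -/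
theorem fq_eq (h : ℕ → ℝ) {q n : ℕ} (hq : q ≠ 0) (hn : n ≠ 0) :
    fq h q n = ∏ p ∈ q.primeFactors, localFactor h p (q.factorization p) (n.factorization p) := by
  refine Finset.prod_congr rfl fun p _ => ?_
  rw [Nat.factorization_gcd hn hq]
  simp only [Finsupp.inf_apply]
  rcases lt_or_ge (n.factorization p) (q.factorization p) with h1 | h1
  · rw [inf_eq_left.2 h1.le]
  · rw [inf_eq_right.2 h1]
    simp [localFactor, not_lt.2 h1]

/-- The supremum defining `Δ_q(x)` is over a nonempty bounded set. -/
theorem discrepancySet_nonempty_bddAbove (a h : ℕ → ℝ) (ha : ∀ n, 0 ≤ a n) {x : ℝ} (hx : 0 < x)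
    {q : ℕ} (hq : q ≠ 0) :
    (discrepancySet a h x q).Nonempty ∧ BddAbove (discrepancySet a h x q) := by
  refine ⟨⟨_, x, ⟨by linarith, le_rfl⟩, 0, rfl⟩, ?_⟩
  have hT : 0 ≤ total a x := Finset.sum_nonneg fun n _ => ha n
  set M : ℝ := ∑ d ∈ Finset.range (q + 1), |fq h q d / (q * gammaq h q)| with hM
  refine ⟨(total a x + M * total a x) / (total a x / (Nat.totient q : ℝ)), ?_⟩
  rintro r ⟨y, ⟨hy1, hy2⟩, b, rfl⟩
  refine div_le_div_of_nonneg_right ?_ (div_nonneg hT (Nat.cast_nonneg _))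
  have h1 : 0 ≤ totalAP a y q b := Finset.sum_nonneg fun n _ => ha n
  have h2 : totalAP a y q b ≤ total a x :=
    Finset.sum_le_sum_of_subset_of_nonneg
      ((Finset.filter_subset _ _).trans (Finset.Icc_subset_Icc le_rfl (Nat.floor_mono hy2)))
      fun n _ _ => ha n
  have hf : fq h q b = fq h q (Nat.gcd b q) := by simp [fq]
  have h3 : |fq h q b / (q * gammaq h q)| ≤ M := by
    rw [hf, hM]
    exact Finset.single_le_sum (f := fun d => |fq h q d / (q * gammaq h q)|)
      (fun _ _ => abs_nonneg _)
      (Finset.mem_range.2 (Nat.lt_succ_of_le (Nat.gcd_le_right b (Nat.pos_of_ne_zero hq))))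
  have hyx : |y / x| ≤ 1 := by
    rw [abs_of_nonneg (div_nonneg (by linarith) hx.le)]
    exact (div_le_one hx).2 hy2
  refine (abs_sub _ _).trans (add_le_add (by rwa [abs_of_nonneg h1]) ?_)
  rw [abs_mul, abs_mul, abs_of_nonneg hT]
  refine mul_le_mul_of_nonneg_right ?_ hT
  calc |fq h q b / (q * gammaq h q)| * |y / x| ≤ M * 1 :=
        mul_le_mul h3 hyx (abs_nonneg _) ((abs_nonneg _).trans h3)
    _ = M := mul_one M

end

end ArithSeq

/-! Let `q` be the product of the primes in `[z^(1-η), z]` and put `g(p) = 1 - f_q(p)`, which is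
`defect`. Expanding over the divisors of `q` shows that `∑_{n ≤ y} f_q(n)` equals `γ_q y` minus the
remainder `R(y) = ∑_{d ∣ q} μ(d) g(d) {y/d}`, which is `fractSum`. The proof shows that `R` is
sometimes large, and that this spoils the distribution of `a`.

Analytic half. The Mellin transform of `R` at `-s` is that of `{x}`, namely `-ζ(s)/s`, times `∏ (1 -
g(p) p^(-s))` (`mellin_fractSum`). At height `π / log z` each `p^(-s)` is close to `-p^(-σ)`, so the
product is about `exp(∑ g(p) p^(-σ))`, nearly what absolute values would give
(`le_norm_prod_one_sub`). Choose `σ = 1 - λ / log z` so that this sum is `w`, slightly above `u`.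
Moving `σ` by `±3η / log z` bounds the parts of the Mellin integral below `z^u` and above `z^V`, `V
= (1+6η)w`; the condition `u ≥ 5/η²` makes them smaller than the whole. So `R(y)/y` must be large
for some `y` in between (`exists_abs_fractSum_gt`).

Arithmetic half. Maier's matrix has entries `a(rq + sl)` with `s ≤ N = ⌊y⌋` and `l` an auxiliary
prime of size about `x/y`. Columns are progressions mod `q` and see the mean of `f_q` up to `N`;
rows are progressions mod `l`, where the normalised mean of `f_l` is `1 + O(1/l)`. Both count the
same sum, so a large `R(N)` forces `Δ_q` or `Δ_l` to be large (`maier_matrix`,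
`abs_fractSum_le_Delta`). Both moduli are at most `x/z^u` and have no prime factor up to `log log
x`. -/

section

/-! ### Chebyshev and Mertens bounds for primes up to `z`. -/

open Finset Real

/-- Mertens' upper bound. -/
theorem sum_log_prime_div_le {n : ℕ} (hn : 1 ≤ n) :
    ∑ p ∈ (Icc 1 n).filter Nat.Prime, log p / p ≤ log n + log 4 := by
  have hn0 : (0 : ℝ) < n := by exact_mod_cast hn
  -- The powers `p^⌊n/p⌋` are pairwise coprime divisors of `n!`, and `n! ≤ n^n`. Chebyshev's bound
  -- below pays for replacing `⌊n/p⌋` by `n/p`.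
  have hfac : ∑ p ∈ (Icc 1 n).filter Nat.Prime, ((n / p : ℕ) : ℝ) * log p ≤ n * log n := by
    have hdvd : ∏ p ∈ (Icc 1 n).filter Nat.Prime, p ^ (n / p) ∣ n.factorial := by
      refine Finset.prod_dvd_of_isRelPrime (fun p hp q hq hpq => ?_) fun p hp => ?_
      · simp only [coe_filter, Set.mem_ofPred_eq] at hp hq
        exact Nat.coprime_iff_isRelPrime.1 (((Nat.coprime_primes hp.2 hq.2).2 hpq).pow _ _)
      · obtain ⟨hp1, hp2⟩ := mem_filter.1 hp
        refine (hp2.pow_dvd_iff_le_factorization (Nat.factorial_ne_zero n)).2 ?_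
        rw [Nat.factorization_factorial hp2 (Nat.lt_succ_self (Nat.log p n))]
        have h1 : 1 ∈ Ico 1 (Nat.log p n).succ := by
          refine mem_Ico.2 ⟨le_rfl, Nat.succ_lt_succ ?_⟩
          exact Nat.log_pos hp2.one_lt (mem_Icc.1 hp1).2
        simpa using single_le_sum (f := fun i => n / p ^ i) (fun _ _ => Nat.zero_le _) h1
    have hle : (∏ p ∈ (Icc 1 n).filter Nat.Prime, (p : ℝ) ^ (n / p)) ≤ (n : ℝ) ^ n := by
      exact_mod_cast (Nat.le_of_dvd (Nat.factorial_pos n) hdvd).trans (Nat.factorial_le_pow n)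
    have hpos : ∀ p ∈ (Icc 1 n).filter Nat.Prime, (p : ℝ) ^ (n / p) ≠ 0 := fun p hp =>
      pow_ne_zero _ (Nat.cast_ne_zero.2 (mem_filter.1 hp).2.ne_zero)
    have := log_le_log (prod_pos fun p hp => lt_of_le_of_ne (by positivity) (hpos p hp).symm) hle
    rw [log_prod hpos] at this
    simpa [log_pow] using this
  have htheta : ∑ p ∈ (Icc 1 n).filter Nat.Prime, log p ≤ log 4 * n := by
    have := Chebyshev.theta_le_log4_mul_x (x := n) hn0.le
    rw [Chebyshev.theta, Nat.floor_natCast] at this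
    exact this
  have hmain : n * ∑ p ∈ (Icc 1 n).filter Nat.Prime, log p / p ≤ n * (log n + log 4) := by
    calc n * ∑ p ∈ (Icc 1 n).filter Nat.Prime, log p / p
        ≤ ∑ p ∈ (Icc 1 n).filter Nat.Prime, (((n / p : ℕ) : ℝ) * log p + log p) := by
          rw [mul_sum]
          refine sum_le_sum fun p hp => ?_
          have hp0 : 0 < p := (mem_filter.1 hp).2.pos
          have hlog : 0 ≤ log p := log_natCast_nonneg p
          have : (n : ℝ) / p ≤ ((n / p : ℕ) : ℝ) + 1 := by
            rw [← Nat.floor_div_eq_div (K := ℝ)]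
            exact (Nat.lt_floor_add_one _).le
          calc (n : ℝ) * (log p / p) = n / p * log p := by ring
            _ ≤ (((n / p : ℕ) : ℝ) + 1) * log p := mul_le_mul_of_nonneg_right this hlog
            _ = _ := by ring
      _ ≤ n * log n + log 4 * n := by rw [sum_add_distrib]; exact add_le_add hfac htheta
      _ = _ := by ring
  exact le_of_mul_le_mul_left hmain hn0

/-- The primes in `[w, z]`. -/
noncomputable def primesIn (w z : ℝ) : Finset ℕ := (Icc ⌈w⌉₊ ⌊z⌋₊).filter Nat.Prime

theorem mem_primesIn {w z : ℝ} {p : ℕ} (hp : p ∈ primesIn w z) :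
    p.Prime ∧ w ≤ p ∧ (p : ℝ) ≤ z := by
  obtain ⟨h1, h2⟩ := mem_filter.1 hp
  obtain ⟨h3, h4⟩ := mem_Icc.1 h1
  exact ⟨h2, Nat.ceil_le.1 h3, (Nat.le_floor_iff' h2.ne_zero).1 h4⟩

/-- Each prime here has `log p ≥ log w`, which reduces to Mertens. The bound is crude, but for `w =
z^(1-η)` it is bounded, and that suffices. -/
theorem sum_inv_primesIn_le {w z : ℝ} (hw : 1 < w) (hz : 1 ≤ z) :
    ∑ p ∈ primesIn w z, 1 / (p : ℝ) ≤ (log z + log 4) / log w := by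
  rw [le_div_iff₀ (log_pos hw), sum_mul]
  have hfl : 1 ≤ ⌊z⌋₊ := Nat.le_floor (by simpa using hz)
  calc ∑ p ∈ primesIn w z, 1 / (p : ℝ) * log w
      ≤ ∑ p ∈ primesIn w z, log p / p := by
        refine sum_le_sum fun p hp => ?_
        obtain ⟨h1, h2, -⟩ := mem_primesIn hp
        rw [one_div_mul_eq_div]
        exact div_le_div_of_nonneg_right (log_le_log (by linarith) h2) (Nat.cast_nonneg _)
    _ ≤ ∑ p ∈ (Icc 1 ⌊z⌋₊).filter Nat.Prime, log p / p := by
        refine sum_le_sum_of_subset_of_nonneg (fun p hp => ?_) fun p _ _ =>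
          div_nonneg (log_natCast_nonneg p) (Nat.cast_nonneg p)
        obtain ⟨h1, h2⟩ := mem_filter.1 hp
        exact mem_filter.2 ⟨mem_Icc.2 ⟨h2.one_le, (mem_Icc.1 h1).2⟩, h2⟩
    _ ≤ log ⌊z⌋₊ + log 4 := sum_log_prime_div_le hfl
    _ ≤ log z + log 4 := by
        gcongr
        exact Nat.floor_le (by linarith)

theorem prod_primesIn_le {w z : ℝ} (hz : 0 ≤ z) :
    ((∏ p ∈ primesIn w z, p : ℕ) : ℝ) ≤ exp (log 4 * z) := by
  have h1 : ∏ p ∈ primesIn w z, p ≤ primorial ⌊z⌋₊ := by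
    refine prod_le_prod_of_subset_of_one_le' (fun p hp => ?_) fun p hp _ => ?_
    · obtain ⟨h1, h2⟩ := mem_filter.1 hp
      exact mem_filter.2 ⟨mem_range.2 (Nat.lt_succ_of_le (mem_Icc.1 h1).2), h2⟩
    · exact (mem_filter.1 hp).2.one_le
  have h2 := h1.trans (primorial_le_four_pow ⌊z⌋₊)
  calc ((∏ p ∈ primesIn w z, p : ℕ) : ℝ) ≤ (4 : ℝ) ^ ⌊z⌋₊ := by exact_mod_cast h2
    _ = (4 : ℝ) ^ (⌊z⌋₊ : ℝ) := (rpow_natCast _ _).symm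
    _ ≤ (4 : ℝ) ^ z := rpow_le_rpow_of_exponent_le (by norm_num) (Nat.floor_le hz)
    _ = _ := by rw [rpow_def_of_pos (by norm_num)]

end

/-! ### The Mellin transform of the fractional part. -/

section

open MeasureTheory Set

/-- From `{x} ≤ x`; this gives convergence at `0` when `σ < 1`. The companion bound from `{x} ≤ 1`
gives convergence at infinity when `σ > 0`. -/
theorem fract_mul_rpow_le {σ x : ℝ} (hx : 0 < x) :
    Int.fract x * x ^ (-σ - 1) ≤ x ^ (-σ) := by
  have h : Int.fract x ≤ x := by
    have := Int.floor_nonneg.2 hx.le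
    rw [Int.fract, sub_le_self_iff]
    exact_mod_cast this
  calc Int.fract x * x ^ (-σ - 1) ≤ x * x ^ (-σ - 1) := by gcongr
    _ = x ^ (-σ) := by rw [Real.rpow_sub_one hx.ne', mul_div_cancel₀ _ hx.ne']

theorem fract_mul_rpow_le' {σ x : ℝ} (hx : 0 < x) :
    Int.fract x * x ^ (-σ - 1) ≤ x ^ (-σ - 1) :=
  mul_le_of_le_one_left (Real.rpow_nonneg hx.le _) (Int.fract_lt_one x).le

theorem fract_mul_rpow_nonneg {σ x : ℝ} (hx : 0 < x) : 0 ≤ Int.fract x * x ^ (-σ - 1) :=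
  mul_nonneg (Int.fract_nonneg x) (Real.rpow_nonneg hx.le _)

theorem measurable_fract_mul_rpow (σ : ℝ) :
    Measurable fun x : ℝ => Int.fract x * x ^ (-σ - 1) :=
  measurable_fract.mul (measurable_id.pow_const _)

theorem integrableOn_Ioc_rpow_neg {σ : ℝ} (hσ : σ < 1) {b : ℝ} (hb : 0 ≤ b) :
    IntegrableOn (fun x : ℝ => x ^ (-σ)) (Ioc 0 b) := by
  have := intervalIntegral.intervalIntegrable_rpow' (a := 0) (b := b) (r := -σ) (by linarith)
  rwa [intervalIntegrable_iff_integrableOn_Ioc_of_le hb] at this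

theorem integrableOn_Ioc_fract_mul_rpow {σ : ℝ} (hσ : σ < 1) :
    IntegrableOn (fun x : ℝ => Int.fract x * x ^ (-σ - 1)) (Ioc 0 1) := by
  refine (integrableOn_Ioc_rpow_neg hσ zero_le_one).mono'
    (measurable_fract_mul_rpow σ).aestronglyMeasurable ?_
  filter_upwards [ae_restrict_mem measurableSet_Ioc] with x hx
  rw [Real.norm_of_nonneg (fract_mul_rpow_nonneg hx.1)]
  exact fract_mul_rpow_le hx.1

theorem integrableOn_Ioi_fract_mul_rpow {σ y : ℝ} (hσ : 0 < σ) (hy : 0 < y) :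
    IntegrableOn (fun x : ℝ => Int.fract x * x ^ (-σ - 1)) (Ioi y) := by
  refine (integrableOn_Ioi_rpow_of_lt (a := -σ - 1) (by linarith) hy).mono'
    (measurable_fract_mul_rpow σ).aestronglyMeasurable ?_
  filter_upwards [ae_restrict_mem measurableSet_Ioi] with x hx
  rw [Real.norm_of_nonneg (fract_mul_rpow_nonneg (hy.trans hx))]
  exact fract_mul_rpow_le' (hy.trans hx)

theorem integrableOn_fract_mul_rpow {σ : ℝ} (h0 : 0 < σ) (h1 : σ < 1) :
    IntegrableOn (fun x : ℝ => Int.fract x * x ^ (-σ - 1)) (Ioi 0) := by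
  rw [← Ioc_union_Ioi_eq_Ioi zero_le_one]
  exact (integrableOn_Ioc_fract_mul_rpow h1).union (integrableOn_Ioi_fract_mul_rpow h0 one_pos)

theorem integral_fract_mul_rpow_Ioi_le {σ y : ℝ} (h0 : 0 < σ) (hy : 0 < y) :
    ∫ x in Ioi y, Int.fract x * x ^ (-σ - 1) ≤ y ^ (-σ) / σ := by
  calc ∫ x in Ioi y, Int.fract x * x ^ (-σ - 1) ≤ ∫ x in Ioi y, x ^ (-σ - 1) :=
        setIntegral_mono_on (integrableOn_Ioi_fract_mul_rpow h0 hy)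
          (integrableOn_Ioi_rpow_of_lt (by linarith) hy) measurableSet_Ioi
          fun x hx => fract_mul_rpow_le' (hy.trans hx)
    _ = y ^ (-σ) / σ := by
        rw [integral_Ioi_rpow_of_lt (by linarith) hy, sub_add_cancel, div_neg, neg_div, neg_neg]

theorem integral_fract_mul_rpow_le {σ : ℝ} (h0 : 0 < σ) (h1 : σ < 1) :
    ∫ x in Ioi 0, Int.fract x * x ^ (-σ - 1) ≤ 1 / (1 - σ) + 1 / σ := by
  rw [← Ioc_union_Ioi_eq_Ioi zero_le_one, setIntegral_union Ioc_disjoint_Ioi_same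
    measurableSet_Ioi (integrableOn_Ioc_fract_mul_rpow h1)
    (integrableOn_Ioi_fract_mul_rpow h0 one_pos)]
  refine add_le_add ?_ ((integral_fract_mul_rpow_Ioi_le h0 one_pos).trans_eq (by simp))
  calc ∫ x in Ioc (0 : ℝ) 1, Int.fract x * x ^ (-σ - 1) ≤ ∫ x in Ioc (0 : ℝ) 1, x ^ (-σ) :=
        setIntegral_mono_on (integrableOn_Ioc_fract_mul_rpow h1)
          (integrableOn_Ioc_rpow_neg h1 zero_le_one) measurableSet_Ioc
          fun x hx => fract_mul_rpow_le hx.1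
    _ = 1 / (1 - σ) := by
        rw [← intervalIntegral.integral_of_le zero_le_one, integral_rpow (Or.inl (by linarith)),
          Real.zero_rpow (by linarith), Real.one_rpow]
        ring_nf

theorem norm_cpow_smul_ofReal {x : ℝ} (hx : 0 < x) (s : ℂ) (c : ℝ) :
    ‖(x : ℂ) ^ (-s - 1) • (c : ℂ)‖ = |c| * x ^ (-s.re - 1) := by
  rw [norm_smul, Complex.norm_cpow_eq_rpow_re_of_pos hx, Complex.norm_real, Real.norm_eq_abs,
    mul_comm]
  simp

theorem mellinConvergent_ofReal {f : ℝ → ℝ} (hf : Measurable f) {s : ℂ}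
    (hint : IntegrableOn (fun x => |f x| * x ^ (-s.re - 1)) (Ioi 0)) :
    MellinConvergent (fun x => (f x : ℂ)) (-s) := by
  refine hint.mono' ?_ ?_
  · refine Measurable.aestronglyMeasurable ?_
    exact (Complex.measurable_ofReal.pow_const _).smul (Complex.measurable_ofReal.comp hf)
  · filter_upwards [ae_restrict_mem measurableSet_Ioi] with x hx
    exact (norm_cpow_smul_ofReal hx s _).le

theorem norm_mellin_ofReal_le (f : ℝ → ℝ) (s : ℂ) :
    ‖mellin (fun x => (f x : ℂ)) (-s)‖ ≤ ∫ x in Ioi 0, |f x| * x ^ (-s.re - 1) := by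
  refine (norm_integral_le_integral_norm _).trans_eq ?_
  exact setIntegral_congr_fun measurableSet_Ioi fun x hx => norm_cpow_smul_ofReal hx s _

theorem mellinConvergent_fract {s : ℂ} (h0 : 0 < s.re) (h1 : s.re < 1) :
    MellinConvergent (fun x => ((Int.fract x : ℝ) : ℂ)) (-s) := by
  refine mellinConvergent_ofReal measurable_fract ?_
  simpa only [Int.abs_fract] using integrableOn_fract_mul_rpow h0 h1

theorem re_cpow_smul_ofReal {x : ℝ} (hx : 0 < x) (s : ℂ) (c : ℝ) :
    ((x : ℂ) ^ (-s - 1) • (c : ℂ)).re = c * x ^ (-s.re - 1) * Real.cos (s.im * Real.log x) := by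
  rw [smul_eq_mul, Complex.cpow_def_of_ne_zero (Complex.ofReal_ne_zero.2 hx.ne'),
    ← Complex.ofReal_log hx.le, Complex.re_mul_ofReal, Complex.exp_re, Real.rpow_def_of_pos hx]
  simp only [Complex.mul_re, Complex.mul_im, Complex.sub_re, Complex.sub_im, Complex.neg_re,
    Complex.neg_im, Complex.ofReal_re, Complex.ofReal_im, Complex.one_re, Complex.one_im]
  rw [← Real.cos_neg (s.im * Real.log x)]
  ring_nf

/-- For `s` close to the real axis the Mellin transform of the fractional part, that is
`-ζ(s)/s`, is not small. -/
theorem le_norm_mellin_fract {s : ℂ} {y : ℝ} (h0 : 0 < s.re) (h1 : s.re < 1) (hy : 1 ≤ y)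
    (ht : 0 ≤ s.im) (hty : s.im * Real.log y ≤ Real.pi / 2) :
    (1 - s.re) / ((1 - s.re) ^ 2 + s.im ^ 2) - y ^ (-s.re) / s.re ≤
      ‖mellin (fun x => ((Int.fract x : ℝ) : ℂ)) (-s)‖ := by
  set F : ℝ → ℂ := fun x => (x : ℂ) ^ (-s - 1) • ((Int.fract x : ℝ) : ℂ) with hF
  have hconv : IntegrableOn F (Ioi 0) := mellinConvergent_fract h0 h1
  have hy0 : 0 < y := by linarith
  -- On `(0, 1)` the fractional part is `x` itself; this piece is the pole of zeta and the main
  -- term.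
  have hA : ∫ x in Ioc (0 : ℝ) 1, F x = 1 / (1 - s) := by
    have hs : -s + 1 ≠ 0 := by
      intro h
      have := congrArg Complex.re h
      simp at this
      linarith
    calc ∫ x in Ioc (0 : ℝ) 1, F x = ∫ x in Ioc (0 : ℝ) 1, (x : ℂ) ^ (-s) := by
          rw [integral_Ioc_eq_integral_Ioo, integral_Ioc_eq_integral_Ioo]
          refine setIntegral_congr_fun measurableSet_Ioo fun x hx => ?_
          have hx0 : (x : ℂ) ≠ 0 := Complex.ofReal_ne_zero.2 hx.1.ne'
          simp only [hF, Int.fract_eq_self.2 ⟨hx.1.le, hx.2⟩, smul_eq_mul]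
          rw [Complex.cpow_sub _ _ hx0, Complex.cpow_one, div_mul_cancel₀ _ hx0]
      _ = 1 / (1 - s) := by
          rw [← intervalIntegral.integral_of_le zero_le_one, integral_cpow (Or.inl (by simpa using h1))]
          rw [Complex.ofReal_zero, Complex.zero_cpow hs, Complex.ofReal_one, Complex.one_cpow]
          ring_nf
  -- Up to `y` the phase `s.im * log x` stays in `[0, π/2]`, so this piece has nonnegative real part
  -- and can be dropped.
  have hB : 0 ≤ (∫ x in Ioc 1 y, F x).re := by
    have hi : IntegrableOn F (Ioc 1 y) := hconv.mono_set fun x hx => lt_trans one_pos hx.1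
    have : (∫ x in Ioc 1 y, F x).re = ∫ x in Ioc 1 y, (F x).re := (integral_re hi).symm
    rw [this]
    refine setIntegral_nonneg measurableSet_Ioc fun x hx => ?_
    have hx0 : 0 < x := lt_trans one_pos hx.1
    rw [hF, re_cpow_smul_ofReal hx0]
    refine mul_nonneg (fract_mul_rpow_nonneg hx0) (Real.cos_nonneg_of_mem_Icc ⟨?_, ?_⟩)
    · have : 0 ≤ s.im * Real.log x := mul_nonneg ht (Real.log_nonneg hx.1.le)
      linarith [Real.pi_pos]
    · refine le_trans ?_ hty
      gcongr
      exact hx.2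
  have hC : ‖∫ x in Ioi y, F x‖ ≤ y ^ (-s.re) / s.re := by
    refine (norm_integral_le_integral_norm _).trans
      (le_trans (le_of_eq ?_) (integral_fract_mul_rpow_Ioi_le h0 hy0))
    refine setIntegral_congr_fun measurableSet_Ioi fun x hx => ?_
    simp only [hF]
    rw [norm_cpow_smul_ofReal (hy0.trans hx), abs_of_nonneg (Int.fract_nonneg _)]
  have hsplit : mellin (fun x => ((Int.fract x : ℝ) : ℂ)) (-s) =
      (∫ x in Ioc (0 : ℝ) 1, F x) + (∫ x in Ioc 1 y, F x) + ∫ x in Ioi y, F x := by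
    have hd : Disjoint (Ioc (0 : ℝ) 1) (Ioc 1 y) := Ioc_disjoint_Ioc_of_le le_rfl
    rw [← setIntegral_union hd measurableSet_Ioc (hconv.mono_set fun x hx => hx.1)
      (hconv.mono_set fun x hx => lt_trans one_pos hx.1),
      Ioc_union_Ioc_eq_Ioc zero_le_one hy, ← setIntegral_union Ioc_disjoint_Ioi_same
      measurableSet_Ioi (hconv.mono_set fun x hx => hx.1)
      (hconv.mono_set fun x hx => hy0.trans hx), Ioc_union_Ioi_eq_Ioi hy0.le]
    rfl
  have hre : (1 / (1 - s)).re = (1 - s.re) / ((1 - s.re) ^ 2 + s.im ^ 2) := by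
    rw [one_div, Complex.inv_re, Complex.normSq_apply]
    simp only [Complex.sub_re, Complex.sub_im, Complex.one_re, Complex.one_im]
    ring_nf
  refine le_trans ?_ (Complex.re_le_norm _)
  rw [hsplit, Complex.add_re, Complex.add_re, hA, hre]
  have := (abs_le.1 ((Complex.abs_re_le_norm (∫ x in Ioi y, F x)).trans hC)).1
  linarith

end

/-! ### The remainder `fractSum`: Mellin transform, tail bounds, and its link with mean values. -/

section

open MeasureTheory Set

/-- The remainder `∑_{d ∣ q} μ(d) g(d) {x / d}` attached to a finite set of primes and weights. -/
noncomputable def fractSum (P : Finset ℕ) (g : ℕ → ℝ) (x : ℝ) : ℝ :=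
  ∑ T ∈ P.powerset, (∏ p ∈ T, -g p) * Int.fract (x / (∏ p ∈ T, p : ℕ))

theorem measurable_fractSum (P : Finset ℕ) (g : ℕ → ℝ) : Measurable (fractSum P g) :=
  Finset.measurable_fun_sum _ fun _ _ => ((measurable_id.div_const _).fract).const_mul _

theorem prod_pos_of_mem_powerset {P T : Finset ℕ} (hP : ∀ p ∈ P, 0 < p) (hT : T ∈ P.powerset) :
    0 < ∏ p ∈ T, p :=
  Finset.prod_pos fun p hp => hP p (Finset.mem_powerset.1 hT hp)

theorem abs_fractSum_le {P : Finset ℕ} {g : ℕ → ℝ} (hg : ∀ p ∈ P, 0 ≤ g p) (x : ℝ) :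
    |fractSum P g x| ≤ ∑ T ∈ P.powerset, (∏ p ∈ T, g p) * Int.fract (x / (∏ p ∈ T, p : ℕ)) := by
  refine (Finset.abs_sum_le_sum_abs _ _).trans (Finset.sum_le_sum fun T hT => ?_)
  rw [abs_mul, Finset.abs_prod, Int.abs_fract]
  refine mul_le_mul_of_nonneg_right (le_of_eq ?_) (Int.fract_nonneg _)
  refine Finset.prod_congr rfl fun p hp => ?_
  rw [abs_neg, abs_of_nonneg (hg p (Finset.mem_powerset.1 hT hp))]

theorem fract_div_mul_rpow {d σ x : ℝ} (hd : 0 < d) (hx : 0 < x) :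
    Int.fract (x / d) * x ^ (-σ - 1) =
      d ^ (-σ - 1) * (Int.fract (d⁻¹ * x) * (d⁻¹ * x) ^ (-σ - 1)) := by
  rw [Real.mul_rpow (inv_pos.2 hd).le hx.le, Real.inv_rpow hd.le, div_eq_inv_mul]
  have : d ^ (-σ - 1) ≠ 0 := (Real.rpow_pos_of_pos hd _).ne'
  field_simp

theorem integrableOn_fract_div_mul_rpow {d σ : ℝ} (hd : 0 < d) (h0 : 0 < σ) (h1 : σ < 1) :
    IntegrableOn (fun x : ℝ => Int.fract (x / d) * x ^ (-σ - 1)) (Ioi 0) := by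
  have h := (integrableOn_Ioi_comp_mul_left_iff (fun x : ℝ => Int.fract x * x ^ (-σ - 1)) 0
    (inv_pos.2 hd)).2 (by simpa using integrableOn_fract_mul_rpow h0 h1)
  exact (integrableOn_congr_fun (fun x hx => fract_div_mul_rpow hd hx) measurableSet_Ioi).2
    (h.const_mul _)

theorem integral_fract_div_mul_rpow {d σ : ℝ} (hd : 0 < d) :
    ∫ x in Ioi 0, Int.fract (x / d) * x ^ (-σ - 1) =
      d ^ (-σ) * ∫ x in Ioi 0, Int.fract x * x ^ (-σ - 1) := by
  rw [setIntegral_congr_fun measurableSet_Ioi fun x hx => fract_div_mul_rpow hd hx,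
    integral_const_mul,
    integral_comp_mul_left_Ioi (fun x : ℝ => Int.fract x * x ^ (-σ - 1)) 0 (inv_pos.2 hd),
    mul_zero, inv_inv, smul_eq_mul, ← mul_assoc, Real.rpow_sub_one hd.ne', div_mul_cancel₀ _ hd.ne']

theorem integrableOn_abs_fractSum {P : Finset ℕ} {g : ℕ → ℝ} (hP : ∀ p ∈ P, 0 < p)
    (hg : ∀ p ∈ P, 0 ≤ g p) {σ : ℝ} (h0 : 0 < σ) (h1 : σ < 1) :
    IntegrableOn (fun x => |fractSum P g x| * x ^ (-σ - 1)) (Ioi 0) := by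
  have hint : IntegrableOn (fun x : ℝ => ∑ T ∈ P.powerset,
      (∏ p ∈ T, g p) * (Int.fract (x / (∏ p ∈ T, p : ℕ)) * x ^ (-σ - 1))) (Ioi 0) :=
    integrable_finsetSum _ fun T hT => (integrableOn_fract_div_mul_rpow
      (Nat.cast_pos.2 (prod_pos_of_mem_powerset hP hT)) h0 h1).const_mul _
  refine hint.mono' ?_ ?_
  · exact ((measurable_fractSum P g).abs.mul (measurable_id.pow_const _)).aestronglyMeasurable
  · filter_upwards [ae_restrict_mem measurableSet_Ioi] with x hx
    have hx' : 0 ≤ x ^ (-σ - 1) := Real.rpow_nonneg (le_of_lt hx) _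
    rw [Real.norm_of_nonneg (mul_nonneg (abs_nonneg _) hx')]
    refine (mul_le_mul_of_nonneg_right (abs_fractSum_le hg x) hx').trans_eq ?_
    rw [Finset.sum_mul]
    exact Finset.sum_congr rfl fun T _ => mul_assoc _ _ _

/-- Termwise, rescaling `x` by `d` pulls out `d^(-σ)`, and the resulting sum over products of
subsets of `P` is an Euler product. -/
theorem integral_abs_fractSum_le {P : Finset ℕ} {g : ℕ → ℝ} (hP : ∀ p ∈ P, 0 < p)
    (hg : ∀ p ∈ P, 0 ≤ g p) {σ : ℝ} (h0 : 0 < σ) (h1 : σ < 1) :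
    ∫ x in Ioi 0, |fractSum P g x| * x ^ (-σ - 1) ≤
      (1 / (1 - σ) + 1 / σ) * ∏ p ∈ P, (1 + g p * (p : ℝ) ^ (-σ)) := by
  have hT' : ∀ T ∈ P.powerset, IntegrableOn (fun x : ℝ => (∏ p ∈ T, g p) *
      (Int.fract (x / (∏ p ∈ T, p : ℕ)) * x ^ (-σ - 1))) (Ioi 0) := fun T hT =>
    (integrableOn_fract_div_mul_rpow
      (Nat.cast_pos.2 (prod_pos_of_mem_powerset hP hT)) h0 h1).const_mul _
  calc ∫ x in Ioi 0, |fractSum P g x| * x ^ (-σ - 1)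
      ≤ ∫ x : ℝ in Ioi 0, ∑ T ∈ P.powerset,
          (∏ p ∈ T, g p) * (Int.fract (x / (∏ p ∈ T, p : ℕ)) * x ^ (-σ - 1)) := by
        refine setIntegral_mono_on (integrableOn_abs_fractSum hP hg h0 h1)
          (integrable_finsetSum _ hT') measurableSet_Ioi fun x hx => ?_
        have hx' : 0 ≤ x ^ (-σ - 1) := Real.rpow_nonneg (le_of_lt hx) _
        refine (mul_le_mul_of_nonneg_right (abs_fractSum_le hg x) hx').trans_eq ?_
        rw [Finset.sum_mul]
        exact Finset.sum_congr rfl fun T _ => mul_assoc _ _ _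
    _ = ∑ T ∈ P.powerset, (∏ p ∈ T, g p) * (((∏ p ∈ T, p : ℕ) : ℝ) ^ (-σ) *
          ∫ x in Ioi 0, Int.fract x * x ^ (-σ - 1)) := by
        rw [integral_finsetSum _ hT']
        refine Finset.sum_congr rfl fun T hT => ?_
        rw [integral_const_mul, integral_fract_div_mul_rpow
          (Nat.cast_pos.2 (prod_pos_of_mem_powerset hP hT))]
    _ = (∫ x in Ioi 0, Int.fract x * x ^ (-σ - 1)) * ∏ p ∈ P, (1 + g p * (p : ℝ) ^ (-σ)) := by
        rw [Finset.prod_one_add, Finset.mul_sum]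
        refine Finset.sum_congr rfl fun T _ => ?_
        rw [Finset.prod_mul_distrib, Nat.cast_prod,
          ← Real.finsetProd_rpow T _ fun _ _ => Nat.cast_nonneg _]
        ring
    _ ≤ _ := by
        refine mul_le_mul_of_nonneg_right (integral_fract_mul_rpow_le h0 h1) ?_
        exact Finset.prod_nonneg fun p hp =>
          add_nonneg zero_le_one (mul_nonneg (hg p hp) (Real.rpow_nonneg (Nat.cast_nonneg _) _))

theorem natCast_prod_cpow (T : Finset ℕ) (s : ℂ) :
    ((∏ p ∈ T, p : ℕ) : ℂ) ^ s = ∏ p ∈ T, (p : ℂ) ^ s := by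
  induction T using Finset.induction_on with
  | empty => simp
  | insert a T ha ih =>
    rw [Finset.prod_insert ha, Finset.prod_insert ha, Nat.cast_mul,
      Complex.natCast_mul_natCast_cpow, ih]

theorem mellin_fractSum {P : Finset ℕ} {g : ℕ → ℝ} (hP : ∀ p ∈ P, 0 < p) {s : ℂ}
    (h0 : 0 < s.re) (h1 : s.re < 1) :
    mellin (fun x => (fractSum P g x : ℂ)) (-s) =
      mellin (fun x => ((Int.fract x : ℝ) : ℂ)) (-s) *
        ∏ p ∈ P, (1 - (g p : ℂ) * (p : ℂ) ^ (-s)) := by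
  set φ : ℝ → ℂ := fun x => ((Int.fract x : ℝ) : ℂ) with hφ
  have hconv : MellinConvergent φ (-s) := mellinConvergent_fract h0 h1
  have hT : ∀ T ∈ P.powerset, IntegrableOn (fun x : ℝ => (∏ p ∈ T, -(g p : ℂ)) *
      ((x : ℂ) ^ (-s - 1) • φ (((∏ p ∈ T, p : ℕ) : ℝ)⁻¹ * x))) (Ioi 0) := fun T hT =>
    (((MellinConvergent.comp_mul_left (f := φ)
      (inv_pos.2 (Nat.cast_pos.2 (prod_pos_of_mem_powerset hP hT)))).2 hconv).const_mul _)
  calc mellin (fun x => (fractSum P g x : ℂ)) (-s)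
      = ∫ x : ℝ in Ioi 0, ∑ T ∈ P.powerset, (∏ p ∈ T, -(g p : ℂ)) *
          ((x : ℂ) ^ (-s - 1) • φ (((∏ p ∈ T, p : ℕ) : ℝ)⁻¹ * x)) := by
        refine setIntegral_congr_fun measurableSet_Ioi fun x _ => ?_
        simp only [fractSum, hφ, smul_eq_mul, Complex.ofReal_sum, Finset.mul_sum]
        refine Finset.sum_congr rfl fun T _ => ?_
        rw [div_eq_inv_mul]
        push_cast
        ring
    _ = ∑ T ∈ P.powerset, (∏ p ∈ T, -(g p : ℂ)) *
          (((∏ p ∈ T, p : ℕ) : ℂ) ^ (-s) * mellin φ (-s)) := by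
        rw [integral_finsetSum _ hT]
        refine Finset.sum_congr rfl fun T hT => ?_
        have hd := prod_pos_of_mem_powerset hP hT
        have := mellin_comp_mul_left φ (-s) (inv_pos.2 (Nat.cast_pos (α := ℝ).2 hd))
        rw [mellin] at this
        rw [integral_const_mul, this, smul_eq_mul, Complex.ofReal_inv, Complex.ofReal_natCast,
          Complex.inv_cpow _ _ (by rw [Complex.natCast_arg]; exact Real.pi_pos.ne),
          ← Complex.cpow_neg, neg_neg]
    _ = _ := by
        simp_rw [sub_eq_add_neg]
        rw [Finset.prod_one_add, Finset.mul_sum]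
        refine Finset.sum_congr rfl fun T _ => ?_
        rw [natCast_prod_cpow]
        simp_rw [← neg_mul]
        rw [Finset.prod_mul_distrib]
        ring

/-- Rankin's trick: on `E` the exponent `σ` may be traded for `κ` at the cost of `A^(κ-σ)`. It is
used with `κ ≥ σ` on `(0, A]` and with `κ ≤ σ` on `(A, ∞)`. -/
theorem setIntegral_abs_fractSum_le {P : Finset ℕ} {g : ℕ → ℝ} (hP : ∀ p ∈ P, 0 < p)
    (hg : ∀ p ∈ P, 0 ≤ g p) {σ κ A : ℝ} (hσ0 : 0 < σ) (hσ1 : σ < 1) (h0 : 0 < κ) (h1 : κ < 1)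
    (hA : 0 < A) {E : Set ℝ} (hE : MeasurableSet E) (hE0 : E ⊆ Ioi 0)
    (hEA : ∀ x ∈ E, x ^ (κ - σ) ≤ A ^ (κ - σ)) :
    ∫ x in E, |fractSum P g x| * x ^ (-σ - 1) ≤
      A ^ (κ - σ) * ((1 / (1 - κ) + 1 / κ) * ∏ p ∈ P, (1 + g p * (p : ℝ) ^ (-κ))) := by
  have hi := integrableOn_abs_fractSum hP hg h0 h1
  calc ∫ x in E, |fractSum P g x| * x ^ (-σ - 1)
      ≤ ∫ x in E, A ^ (κ - σ) * (|fractSum P g x| * x ^ (-κ - 1)) := by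
        refine setIntegral_mono_on ((integrableOn_abs_fractSum hP hg hσ0 hσ1).mono_set hE0)
          ((hi.mono_set hE0).const_mul _) hE fun x hx => ?_
        have hx0 : 0 < x := hE0 hx
        have : x ^ (-σ - 1) = x ^ (κ - σ) * x ^ (-κ - 1) := by
          rw [← Real.rpow_add hx0]; ring_nf
        rw [this]
        calc _ = x ^ (κ - σ) * (|fractSum P g x| * x ^ (-κ - 1)) := by ring
          _ ≤ _ := mul_le_mul_of_nonneg_right (hEA x hx)
            (mul_nonneg (abs_nonneg _) (Real.rpow_nonneg hx0.le _))
    _ = A ^ (κ - σ) * ∫ x in E, |fractSum P g x| * x ^ (-κ - 1) := integral_const_mul _ _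
    _ ≤ _ := by
        refine mul_le_mul_of_nonneg_left ?_ (Real.rpow_nonneg hA.le _)
        refine le_trans ?_ (integral_abs_fractSum_le hP hg h0 h1)
        refine setIntegral_mono_set hi ?_ (Filter.Eventually.of_forall hE0)
        filter_upwards [ae_restrict_mem measurableSet_Ioi] with x hx
        exact mul_nonneg (abs_nonneg _) (Real.rpow_nonneg (le_of_lt hx) _)

/-- If the Mellin transform of the remainder at `s` exceeds the contributions of the tails
`x ≤ A` and `x > B`, the remainder is large somewhere in `[A, B]`. -/
theorem exists_lt_abs_fractSum {P : Finset ℕ} {g : ℕ → ℝ} (hP : ∀ p ∈ P, 0 < p)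
    (hg : ∀ p ∈ P, 0 ≤ g p) {s : ℂ} {κ₁ κ₂ A B ε : ℝ} (h0 : 0 < s.re) (h1 : s.re < 1)
    (hκ₁ : s.re ≤ κ₁) (hκ₁' : κ₁ < 1) (hκ₂ : 0 < κ₂) (hκ₂' : κ₂ ≤ s.re) (hA : 0 < A) (hAB : A ≤ B)
    (hε : 0 ≤ ε)
    (h : A ^ (κ₁ - s.re) * ((1 / (1 - κ₁) + 1 / κ₁) * ∏ p ∈ P, (1 + g p * (p : ℝ) ^ (-κ₁))) +
      B ^ (κ₂ - s.re) * ((1 / (1 - κ₂) + 1 / κ₂) * ∏ p ∈ P, (1 + g p * (p : ℝ) ^ (-κ₂))) +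
      ε * (B ^ (1 - s.re) / (1 - s.re)) < ‖mellin (fun x => (fractSum P g x : ℂ)) (-s)‖) :
    ∃ x, A ≤ x ∧ x ≤ B ∧ ε * x < |fractSum P g x| := by
  by_contra! hcon
  refine absurd h (not_lt.2 ?_)
  have hB : 0 < B := hA.trans_le hAB
  have hint := integrableOn_abs_fractSum hP hg h0 h1
  refine (norm_mellin_ofReal_le _ _).trans ?_
  rw [← Ioc_union_Ioi_eq_Ioi hB.le, ← Ioc_union_Ioc_eq_Ioc hA.le hAB,
    setIntegral_union, setIntegral_union, add_right_comm]
  · refine add_le_add (add_le_add ?_ ?_) ?_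
    · refine setIntegral_abs_fractSum_le hP hg h0 h1 (h0.trans_le hκ₁) hκ₁' hA measurableSet_Ioc
        (fun x hx => hx.1) fun x hx => ?_
      exact Real.rpow_le_rpow hx.1.le hx.2 (by linarith)
    · refine setIntegral_abs_fractSum_le hP hg h0 h1 hκ₂ (hκ₂'.trans_lt h1) hB measurableSet_Ioi
        (fun x hx => hB.trans hx) fun x hx => ?_
      exact Real.rpow_le_rpow_of_nonpos hB (le_of_lt hx) (by linarith)
    · have hi := integrableOn_Ioc_rpow_neg h1 hB.le
      have hsub : Ioc A B ⊆ Ioc 0 B := fun x hx => ⟨hA.trans hx.1, hx.2⟩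
      calc ∫ x in Ioc A B, |fractSum P g x| * x ^ (-s.re - 1)
          ≤ ∫ x in Ioc A B, ε * x ^ (-s.re) := by
            refine setIntegral_mono_on (hint.mono_set fun x hx => hA.trans hx.1)
              ((hi.mono_set hsub).const_mul _) measurableSet_Ioc fun x hx => ?_
            have hx0 : 0 < x := hA.trans hx.1
            calc _ ≤ ε * x * x ^ (-s.re - 1) :=
                  mul_le_mul_of_nonneg_right (hcon x hx.1.le hx.2) (Real.rpow_nonneg hx0.le _)
              _ = _ := by
                rw [Real.rpow_sub_one hx0.ne', mul_assoc, mul_div_cancel₀ _ hx0.ne']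
        _ ≤ ∫ x in Ioc 0 B, ε * x ^ (-s.re) := by
            refine setIntegral_mono_set (hi.const_mul _) ?_ (Filter.Eventually.of_forall hsub)
            filter_upwards [ae_restrict_mem measurableSet_Ioc] with x hx
            exact mul_nonneg hε (Real.rpow_nonneg hx.1.le _)
        _ = _ := by
            rw [integral_const_mul, ← intervalIntegral.integral_of_le hB.le,
              integral_rpow (Or.inl (by linarith)), Real.zero_rpow (by linarith), sub_zero,
              neg_add_eq_sub]
  · exact Ioc_disjoint_Ioc_of_le le_rfl
  · exact measurableSet_Ioc
  · exact hint.mono_set fun x hx => hx.1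
  · exact hint.mono_set fun x hx => hA.trans hx.1
  · rw [Ioc_union_Ioc_eq_Ioc hA.le hAB]
    exact Ioc_disjoint_Ioi_same
  · exact measurableSet_Ioi
  · exact hint.mono_set fun x hx => by
      rw [Ioc_union_Ioc_eq_Ioc hA.le hAB] at hx; exact hx.1
  · exact hint.mono_set fun x hx => hB.trans hx

theorem prod_one_add_ite_dvd {P : Finset ℕ} (hP : ∀ p ∈ P, p.Prime) (g : ℕ → ℝ) (n : ℕ) :
    ∏ p ∈ P, (if p ∣ n then 1 - g p else 1) =
      ∑ T ∈ P.powerset, (∏ p ∈ T, -g p) * if (∏ p ∈ T, p) ∣ n then 1 else 0 := by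
  have : ∀ p ∈ P, (if p ∣ n then 1 - g p else 1) = 1 + -g p * if p ∣ n then 1 else 0 := by
    intro p _
    split_ifs <;> ring
  rw [Finset.prod_congr rfl this, Finset.prod_one_add]
  refine Finset.sum_congr rfl fun T hT => ?_
  have hT' := Finset.mem_powerset.1 hT
  rw [Finset.prod_mul_distrib, Finset.prod_ite_zero, Finset.prod_const_one]
  congr 1
  refine if_congr ⟨fun h => ?_, fun h p hp => (Finset.dvd_prod_of_mem _ hp).trans h⟩ rfl rfl
  exact Finset.prod_primes_dvd n (fun p hp => (hP p (hT' hp)).prime) h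

/-- The multiples of `d` up to `x` number `⌊x/d⌋ = x/d - {x/d}`; the terms `x/d` assemble into the
Euler product. -/
theorem fractSum_eq {P : Finset ℕ} (g : ℕ → ℝ) {x : ℝ} (hx : 0 ≤ x) :
    fractSum P g x = x * ∏ p ∈ P, (1 - g p / p) -
      ∑ n ∈ Finset.Icc 1 ⌊x⌋₊, ∑ T ∈ P.powerset, (∏ p ∈ T, -g p) *
        if (∏ p ∈ T, p) ∣ n then 1 else 0 := by
  rw [Finset.sum_comm, eq_sub_iff_add_eq]
  simp_rw [sub_eq_add_neg]
  rw [Finset.prod_one_add, Finset.mul_sum, fractSum, ← Finset.sum_add_distrib]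
  refine Finset.sum_congr rfl fun T _ => ?_
  rw [← Finset.mul_sum, Finset.sum_boole, ← mul_add]
  have h1 : ((Finset.Icc 1 ⌊x⌋₊).filter fun n => (∏ p ∈ T, p) ∣ n).card = ⌊x⌋₊ / ∏ p ∈ T, p :=
    Nat.Ioc_filter_dvd_card_eq_div _ _
  rw [h1, ← Nat.floor_div_natCast, natCast_floor_eq_intCast_floor (by positivity),
    Int.fract_add_floor, Nat.cast_prod]
  simp_rw [← neg_div]
  rw [Finset.prod_div_distrib]
  ring

/-- Mean value of the multiplicative function with values `1 - g p` at the multiples of `p ∈ P`. -/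
theorem sum_prod_ite_dvd {P : Finset ℕ} (hP : ∀ p ∈ P, p.Prime) (g : ℕ → ℝ) {x : ℝ} (hx : 0 ≤ x) :
    ∑ n ∈ Finset.Icc 1 ⌊x⌋₊, ∏ p ∈ P, (if p ∣ n then 1 - g p else 1) =
      x * ∏ p ∈ P, (1 - g p / p) - fractSum P g x := by
  rw [fractSum_eq g hx, sub_sub_cancel]
  exact Finset.sum_congr rfl fun n _ => prod_one_add_ite_dvd hP g n

end

/-! ### Oscillation: the remainder is large between `z^u` and `z^(1.2u)`. -/

section

open MeasureTheory Set Real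

/-- `∑ g(p) p^{-κ}` for `κ = 1 - μ / L`. -/
noncomputable def weightSum (P : Finset ℕ) (g : ℕ → ℝ) (L μ : ℝ) : ℝ :=
  ∑ p ∈ P, g p / p * exp (μ * (log p / L))

theorem continuous_weightSum (P : Finset ℕ) (g : ℕ → ℝ) (L : ℝ) :
    Continuous (weightSum P g L) := by
  unfold weightSum
  fun_prop

theorem rpow_one_sub_div {L μ : ℝ} {p : ℕ} (hp : 0 < p) :
    (p : ℝ) ^ (-(1 - μ / L)) = exp (μ * (log p / L)) / p := by
  have hp' : (0 : ℝ) < p := Nat.cast_pos.2 hp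
  rw [rpow_def_of_pos hp', ← exp_log hp', log_exp, ← exp_sub]
  ring_nf

theorem prod_one_add_le_exp_weightSum {P : Finset ℕ} {g : ℕ → ℝ} (hP : ∀ p ∈ P, 0 < p)
    (hg : ∀ p ∈ P, 0 ≤ g p) (L μ : ℝ) :
    ∏ p ∈ P, (1 + g p * (p : ℝ) ^ (-(1 - μ / L))) ≤ exp (weightSum P g L μ) := by
  rw [weightSum, exp_sum]
  refine Finset.prod_le_prod (fun p hp => ?_) fun p hp => ?_
  · exact add_nonneg zero_le_one (mul_nonneg (hg p hp) (rpow_nonneg (Nat.cast_nonneg _) _))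
  · rw [rpow_one_sub_div (hP p hp), mul_div_assoc', div_mul_eq_mul_div, add_comm]
    exact add_one_le_exp _

theorem weightSum_add_le {P : Finset ℕ} {g : ℕ → ℝ} (hg : ∀ p ∈ P, 0 ≤ g p) {L c μ ν : ℝ}
    (h : ∀ p ∈ P, ν * (log p / L) ≤ c) :
    weightSum P g L (μ + ν) ≤ exp c * weightSum P g L μ := by
  rw [weightSum, weightSum, Finset.mul_sum]
  refine Finset.sum_le_sum fun p hp => ?_
  rw [add_mul, exp_add]
  calc g p / p * (exp (μ * (log p / L)) * exp (ν * (log p / L)))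
      ≤ g p / p * (exp (μ * (log p / L)) * exp c) := by
        have := hg p hp
        have := h p hp
        gcongr
    _ = _ := by ring

theorem le_weightSum {P : Finset ℕ} {g : ℕ → ℝ} (hg : ∀ p ∈ P, 0 ≤ g p) {L c μ : ℝ}
    (h : ∀ p ∈ P, c ≤ μ * (log p / L)) :
    exp c * ∑ p ∈ P, g p / p ≤ weightSum P g L μ := by
  rw [weightSum, Finset.mul_sum]
  refine Finset.sum_le_sum fun p hp => ?_
  rw [mul_comm]
  have := hg p hp
  have := h p hp
  gcongr

/-- At height `π / log z` all the `p ^ (-s)` with `p` close to `z` point in nearly the same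
direction, so that the Euler product is large. -/
theorem le_norm_prod_one_sub {P : Finset ℕ} {g : ℕ → ℝ} {L η lam : ℝ} (hP : ∀ p ∈ P, 0 < p)
    (hg : ∀ p ∈ P, 0 ≤ g p) (hg1 : ∀ p ∈ P, g p ≤ 1) (hL : 0 < L)
    (hη : 0 < η) (hη1 : η < 1 / 100)
    (hPl : ∀ p ∈ P, (1 - η) * L ≤ log p) (hPu : ∀ p ∈ P, log p ≤ L)
    (hlam : lam ≤ 0.61 * L) (hηL : log (2 / η) ≤ L / 20) {s : ℂ} (hs : s.re = 1 - lam / L)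
    (ht : s.im = π / L) :
    exp ((1 - 6 * η ^ 2) * weightSum P g L lam) ≤
      ‖∏ p ∈ P, (1 - (g p : ℂ) * (p : ℂ) ^ (-s))‖ := by
  rw [norm_prod, weightSum, Finset.mul_sum, exp_sum]
  refine Finset.prod_le_prod (fun _ _ => (exp_pos _).le) fun p hp => ?_
  have hp0 : (0 : ℝ) < p := Nat.cast_pos.2 (hP p hp)
  set a : ℝ := log p / L with ha
  have ha1 : a ≤ 1 := (div_le_one hL).2 (hPu p hp)
  have ha2 : 1 - η ≤ a := (le_div_iff₀ hL).2 (hPl p hp)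
  set y : ℝ := g p / p * exp (lam * a) with hy
  have hy0 : 0 ≤ y := mul_nonneg (div_nonneg (hg p hp) hp0.le) (exp_pos _).le
  -- `y ≤ p^(-σ)`, and `λ ≤ 0.61 L` makes this about `z^(-0.38)` at most, while `2/η ≤ z^(1/20)`.
  have hyη : y ≤ η ^ 2 := by
    have hlp : log p = a * L := by rw [ha]; field_simp
    have h1 : y ≤ 1 / p * exp (lam * a) := by
      have := hg1 p hp
      rw [hy]
      gcongr
    have h2 : 1 / (p : ℝ) * exp (lam * a) = exp (lam * a - a * L) := by
      rw [exp_sub, ← hlp, exp_log hp0]; ring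
    have h3 : η ^ 2 = exp (2 * log η) := by
      rw [mul_comm, exp_mul, exp_log hη]; norm_num
    rw [h2] at h1
    refine h1.trans ?_
    rw [h3]
    refine exp_le_exp.2 ?_
    rw [log_div two_ne_zero hη.ne'] at hηL
    have := log_pos (one_lt_two (α := ℝ))
    nlinarith
  have hcos : cos (π * a) ≤ -(1 - 5 * η ^ 2) := by
    have h1 : cos (π * a) = -cos (π * (1 - a)) := by
      rw [mul_sub, mul_one, cos_pi_sub, neg_neg]
    have h2 := one_sub_sq_div_two_le_cos (x := π * (1 - a))
    rw [h1]
    have h3 : (π * (1 - a)) ^ 2 ≤ 10 * η ^ 2 := by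
      rw [mul_pow]
      have : π ^ 2 ≤ 10 := by nlinarith [pi_lt_d2, pi_pos]
      have : (1 - a) ^ 2 ≤ η ^ 2 := by nlinarith
      gcongr
    linarith
  have hre : (1 - (g p : ℂ) * (p : ℂ) ^ (-s)).re = 1 - y * cos (π * a) := by
    rw [Complex.sub_re, Complex.one_re, Complex.re_ofReal_mul,
      Complex.cpow_def_of_ne_zero (by exact_mod_cast hp0.ne'), ← Complex.natCast_log,
      Complex.exp_re]
    simp only [Complex.mul_re, Complex.mul_im, Complex.neg_re, Complex.neg_im, Complex.ofReal_re,
      Complex.ofReal_im, hs, ht]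
    have h1 : exp (log p * -(1 - lam / L) - 0 * -(π / L)) = exp (lam * a) / p := by
      rw [← rpow_one_sub_div (hP p hp), rpow_def_of_pos hp0]
      ring_nf
    have h2 : cos (log p * -(π / L) + 0 * -(1 - lam / L)) = cos (π * a) := by
      rw [← cos_neg, ha]
      ring_nf
    rw [h1, h2, hy]
    ring
  set t : ℝ := y * (1 - 5 * η ^ 2) with htdef
  have hη2 : η ^ 2 ≤ 1 / 10000 := by nlinarith
  have ht0 : 0 ≤ t := mul_nonneg hy0 (by linarith)
  have ht1 : t ≤ η ^ 2 := (mul_le_of_le_one_right hy0 (by nlinarith)).trans hyη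
  -- Of the loss `6η²`, the phase costs `5η²` and the inequality `log(1+t) ≥ t(1-t)` with `t ≤ η²`
  -- costs the rest.
  calc exp ((1 - 6 * η ^ 2) * y) ≤ exp (log (1 + t)) := by
        refine exp_le_exp.2 ?_
        have h1 := one_sub_inv_le_log_of_pos (x := 1 + t) (by linarith)
        have h2 : t * (1 - t) ≤ 1 - (1 + t)⁻¹ := by
          rw [inv_eq_one_div, le_sub_comm, div_le_iff₀ (by linarith)]
          nlinarith [mul_nonneg ht0 (mul_nonneg ht0 ht0)]
        have h3 : (1 - 6 * η ^ 2) * y ≤ t * (1 - t) := by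
          have h4 : t * (1 - η ^ 2) ≤ t * (1 - t) := by gcongr
          have h5 : (1 - 6 * η ^ 2) * y ≤ t * (1 - η ^ 2) := by
            rw [htdef]
            nlinarith [mul_nonneg hy0 (mul_nonneg (sq_nonneg η) (sq_nonneg η))]
          linarith
        linarith
    _ = 1 + t := exp_log (by linarith)
    _ ≤ (1 - (g p : ℂ) * (p : ℂ) ^ (-s)).re := by
        rw [hre]
        have := mul_le_mul_of_nonneg_left hcos hy0
        linarith
    _ ≤ _ := Complex.re_le_norm _

theorem exp_ten_lt : exp 10 < 25000 := by
  have h : exp 10 = exp 1 ^ 10 := by rw [← exp_nat_mul]; norm_num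
  rw [h]
  calc exp 1 ^ 10 < 2.7182818286 ^ 10 := by
        gcongr
        exact exp_one_lt_d9
    _ < 25000 := by norm_num

theorem exp_neg_fifteen_lt : exp (-15) < 1 / 100 := by
  have h := exp_one_gt_d9
  rw [exp_neg, inv_eq_one_div]
  refine one_div_lt_one_div_of_lt (by norm_num) ?_
  have h1 : exp 15 = exp 1 ^ 15 := by rw [← exp_nat_mul]; norm_num
  rw [h1]
  calc (100 : ℝ) < 2 ^ 15 := by norm_num
    _ ≤ exp 1 ^ 15 := by gcongr; linarith

/-- Expanding to second order in `η`, the left exponents are about `w(1 - 12η²)` and `w(1 - 9η²)`.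
Both fall short of `w(1 - 6η²)` by at least about `3wη²`, whence the factor `exp(-15)`. -/
theorem exp_weights_le {w η : ℝ} (hη : 0 < η) (hη1 : η < 1 / 100) (hw : 5 ≤ w * η ^ 2) :
    exp (w * (1 - 8 * η) * (3 * η)) * exp (exp (-(3 * η) * (1 - η)) * w) ≤
        exp (-15) * exp ((1 - 6 * η ^ 2) * w) ∧
      exp (-(w * (1 + 6 * η) * (3 * η))) * exp (exp (3 * η) * w) ≤
        exp (-15) * exp ((1 - 6 * η ^ 2) * w) := by
  have hw0 : 0 ≤ w := by
    by_contra h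
    nlinarith [sq_nonneg η]
  have key : ∀ x : ℝ, |x| ≤ 1 → exp x * w ≤ (1 + x + x ^ 2) * w := fun x hx => by
    have := (abs_le.1 (abs_exp_sub_one_sub_id_le hx)).2
    gcongr
    linarith
  constructor
  · rw [← exp_add, ← exp_add]
    refine exp_le_exp.2 ?_
    have h := key (-(3 * η) * (1 - η)) (abs_le.2 ⟨by nlinarith, by nlinarith⟩)
    have h2 : w * η ^ 3 ≤ w * η ^ 2 * (1 / 100) := by
      have : w * η ^ 3 = w * η ^ 2 * η := by ring
      rw [this]; gcongr
    have h3 : w * η ^ 4 ≤ w * η ^ 2 * (1 / 100) := by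
      have : w * η ^ 4 = w * η ^ 2 * (η * η) := by ring
      rw [this]; gcongr; nlinarith
    have h4 : 0 ≤ w * η ^ 3 := by positivity
    nlinarith
  · rw [← exp_add, ← exp_add]
    refine exp_le_exp.2 ?_
    have h := key (3 * η) (abs_le.2 ⟨by linarith, by linarith⟩)
    nlinarith

/-- Cutting at `√z` makes the phase exactly `π/2` there. With `λ ≥ 10` the height `π/L` is small
against `λ/L`, so `Re 1/(1-s)` is at least `0.9 L/λ`, and the tail past `√z` is negligible. -/
theorem half_le_norm_mellin_fract {z lam : ℝ} (hz : 1 < z) (hL100 : 100 ≤ log z)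
    (hlam10 : 10 ≤ lam) (hlamL : lam ≤ 0.61 * log z) :
    1 / 2 * (log z / lam) ≤ ‖mellin (fun x => ((Int.fract x : ℝ) : ℂ))
      (-(⟨1 - lam / log z, π / log z⟩ : ℂ))‖ := by
  set L := log z with hLdef
  have hL : 0 < L := by linarith
  have hz0 : 0 < z := by linarith
  set σ := 1 - lam / L with hσ
  have hlamL' : lam / L ≤ 0.61 := (div_le_iff₀ hL).2 hlamL
  have hlamL0 : 0 < lam / L := by positivity
  set s : ℂ := ⟨σ, π / L⟩ with hs
  refine le_trans ?_ (le_norm_mellin_fract (s := s) (y := √z) (by change 0 < σ; linarith)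
    (by change σ < 1; linarith) (one_le_sqrt.2 hz.le) (by change 0 ≤ π / L; positivity)
    (le_of_eq ?_))
  · change 1 / 2 * (L / lam) ≤ (1 - σ) / ((1 - σ) ^ 2 + (π / L) ^ 2) - √z ^ (-σ) / σ
    have h1 : (1 - σ) / ((1 - σ) ^ 2 + (π / L) ^ 2) = L * lam / (lam ^ 2 + π ^ 2) := by
      rw [hσ]
      field_simp
      ring
    have h2 : 0.9 * (L / lam) ≤ L * lam / (lam ^ 2 + π ^ 2) := by
      rw [le_div_iff₀ (by positivity)]
      have : π ^ 2 ≤ 10 := by nlinarith [pi_lt_d2, pi_pos]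
      calc 0.9 * (L / lam) * (lam ^ 2 + π ^ 2) ≤ 0.9 * (L / lam) * (lam ^ 2 + 10) := by gcongr
        _ ≤ L / lam * lam ^ 2 := by
          have : 0.9 * (lam ^ 2 + 10) ≤ lam ^ 2 := by nlinarith
          have h0 : 0 ≤ L / lam := by positivity
          nlinarith
        _ = L * lam := by field_simp
    have h3 : √z ^ (-σ) / σ ≤ 0.2 := by
      rw [div_le_iff₀ (by linarith), rpow_def_of_pos (sqrt_pos.2 hz0), log_sqrt hz0.le]
      have h4 : exp (L / 2 * -σ) ≤ exp (-15) := exp_le_exp.2 (by nlinarith)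
      linarith [exp_neg_fifteen_lt]
    have h4 : 1 ≤ L / lam := (one_le_div (by linarith)).2 (by linarith)
    rw [h1]
    linarith
  · change π / L * log √z = π / 2
    rw [log_sqrt hz0.le]
    field_simp
    exact hLdef.symm

theorem inv_add_inv_le {L lam ν : ℝ} (hL : 100 ≤ L) (hlam10 : 10 ≤ lam)
    (hlamL : lam ≤ 0.61 * L) (hν : |ν| ≤ 0.03) :
    1 / (1 - (1 - (lam + ν) / L)) + 1 / (1 - (lam + ν) / L) ≤ 3 * (L / lam) := by
  obtain ⟨hν1, hν2⟩ := abs_le.1 hν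
  have hL0 : 0 < L := by linarith
  have hLlam : 1 / 0.61 ≤ L / lam := by
    rw [div_le_div_iff₀ (by norm_num) (by linarith)]
    linarith
  have h1 : 1 / (1 - (1 - (lam + ν) / L)) ≤ 1.01 * (L / lam) := by
    rw [sub_sub_cancel, one_div_div, mul_div_assoc', div_le_div_iff₀ (by linarith) (by linarith)]
    nlinarith
  have h2 : (lam + ν) / L ≤ 0.611 := by
    rw [div_le_iff₀ hL0]; linarith
  have h3 : 1 / (1 - (lam + ν) / L) ≤ 1 / 0.389 :=
    one_div_le_one_div_of_le (by norm_num) (by linarith)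
  norm_num at h3 hLlam h1 ⊢
  linarith

/-- One tail after Rankin's shift by `ν`. Since `log p / L` lies in `[1-η, 1]`, the shift rescales
the exponent sum by at most `e^c`. -/
theorem tail_le {P : Finset ℕ} {g : ℕ → ℝ} (hP : ∀ p ∈ P, 0 < p)
    (hg : ∀ p ∈ P, 0 ≤ g p) {L lam ν c a b : ℝ} (hL : 100 ≤ L) (hlam10 : 10 ≤ lam)
    (hlamL : lam ≤ 0.61 * L) (hν : |ν| ≤ 0.03) (hc : ∀ p ∈ P, ν * (log p / L) ≤ c)
    (hab : exp a * exp (exp c * weightSum P g L lam) ≤ b) :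
    exp a * ((1 / (1 - (1 - (lam + ν) / L)) + 1 / (1 - (lam + ν) / L)) *
      ∏ p ∈ P, (1 + g p * (p : ℝ) ^ (-(1 - (lam + ν) / L)))) ≤ 3 * (L / lam) * b := by
  have h1 : ∏ p ∈ P, (1 + g p * (p : ℝ) ^ (-(1 - (lam + ν) / L))) ≤
      exp (exp c * weightSum P g L lam) :=
    (prod_one_add_le_exp_weightSum hP hg _ _).trans (exp_le_exp.2 (weightSum_add_le hg hc))
  have h0 : 0 ≤ ∏ p ∈ P, (1 + g p * (p : ℝ) ^ (-(1 - (lam + ν) / L))) :=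
    Finset.prod_nonneg fun p hp =>
      add_nonneg zero_le_one (mul_nonneg (hg p hp) (rpow_nonneg (Nat.cast_nonneg _) _))
  have h3 : 0 ≤ 3 * (L / lam) := by
    have : 0 ≤ L / lam := div_nonneg (by linarith) (by linarith)
    linarith
  calc _ ≤ exp a * (3 * (L / lam) * exp (exp c * weightSum P g L lam)) :=
        mul_le_mul_of_nonneg_left (mul_le_mul (inv_add_inv_le hL hlam10 hlamL hν) h1 h0 h3)
          (exp_pos _).le
    _ = 3 * (L / lam) * (exp a * exp (exp c * weightSum P g L lam)) := by ring
    _ ≤ _ := mul_le_mul_of_nonneg_left hab h3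

/-- Intermediate values: the weight sum lies between `B e^((1-η)λ)` and `B e^λ`, where `B = ∑
g(p)/p`. The lower bound `10` comes from `w/B ≥ 25000 > e^10`. -/
theorem exists_weightSum_eq {P : Finset ℕ} {g : ℕ → ℝ} {L η w : ℝ} (hg : ∀ p ∈ P, 0 ≤ g p)
    (hL : 0 < L) (hη' : 0 < 1 - η) (hPl : ∀ p ∈ P, (1 - η) * L ≤ log p)
    (hPu : ∀ p ∈ P, log p ≤ L) (hB0 : 0 < ∑ p ∈ P, g p / p) (hB2 : ∑ p ∈ P, g p / p ≤ 2)
    (hw0 : 50000 ≤ w) :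
    ∃ lam, 10 ≤ lam ∧ lam ≤ log (w / ∑ p ∈ P, g p / p) / (1 - η) ∧ weightSum P g L lam = w := by
  set B := ∑ p ∈ P, g p / p with hBdef
  have hwB0 : 25000 ≤ w / B := by
    rw [le_div_iff₀ hB0]; linarith
  have hlogwB : 0 ≤ log (w / B) := log_nonneg (by linarith)
  set Lam := log (w / B) / (1 - η) with hLam
  have hLam0 : 0 ≤ Lam := div_nonneg hlogwB hη'.le
  obtain ⟨lam, ⟨hlam0, hlamLam⟩, hlamw⟩ : ∃ lam ∈ Icc 0 Lam, weightSum P g L lam = w := by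
    refine intermediate_value_Icc hLam0 (continuous_weightSum P g L).continuousOn ⟨?_, ?_⟩
    · simp only [weightSum, zero_mul, exp_zero, mul_one]
      exact hB2.trans (by linarith)
    · have h := le_weightSum (P := P) (g := g) (L := L) (c := log (w / B)) (μ := Lam) hg
        fun p hp => ?_
      · rwa [exp_log (by positivity), ← hBdef, div_mul_cancel₀ _ hB0.ne'] at h
      · have : 1 - η ≤ log p / L := (le_div_iff₀ hL).2 (hPl p hp)
        calc log (w / B) = Lam * (1 - η) := (div_mul_cancel₀ _ hη'.ne').symm
          _ ≤ _ := by gcongr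
  refine ⟨lam, ?_, hlamLam, hlamw⟩
  have h := weightSum_add_le (P := P) (g := g) (L := L) (c := lam) (μ := 0) (ν := lam) hg
    fun p hp => mul_le_of_le_one_right hlam0 ((div_le_one hL).2 (hPu p hp))
  rw [zero_add, hlamw] at h
  simp only [weightSum, zero_mul, exp_zero, mul_one] at h
  rw [← hBdef, ← div_le_iff₀ hB0] at h
  exact exp_le_exp.1 (exp_ten_lt.le.trans (hwB0.trans h))

set_option maxHeartbeats 800000 in
/-- Oscillation of mean values: the remainder term is not small somewhere between `z ^ u` and
`z ^ (1.2 u)`. -/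
theorem exists_abs_fractSum_gt {P : Finset ℕ} {g : ℕ → ℝ} {z η u : ℝ} (hP : ∀ p ∈ P, 0 < p)
    (hg : ∀ p ∈ P, 0 ≤ g p) (hg1 : ∀ p ∈ P, g p ≤ 1) (hz : 1 < z)
    (hη : 0 < η) (hη1 : η < 1 / 100)
    (hPl : ∀ p ∈ P, z ^ (1 - η) ≤ p) (hPu : ∀ p ∈ P, (p : ℝ) ≤ z)
    (hB : η ^ 2 ≤ ∑ p ∈ P, g p / p) (hB2 : ∑ p ∈ P, g p / p ≤ 2)
    (hηz : log (2 / η) ≤ log z / 20) (hu : 5 / η ^ 2 ≤ u) (huz : u ≤ √z) :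
    ∃ x, z ^ u ≤ x ∧ x ≤ z ^ (1.2 * u) ∧
      1 / 8 * exp (-(u * (1 + 25 * η) * log (2 * u / η ^ 2))) * x < |fractSum P g x| := by
  set L := log z with hLdef
  have hL : 0 < L := log_pos hz
  have hz0 : 0 < z := by linarith
  have hη2 : 0 < η ^ 2 := by positivity
  have hPl' : ∀ p ∈ P, (1 - η) * L ≤ log p := fun p hp => by
    rw [hLdef, ← log_rpow hz0]
    exact log_le_log (rpow_pos_of_pos hz0 _) (hPl p hp)
  have hPu' : ∀ p ∈ P, log p ≤ L := fun p hp =>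
    log_le_log (Nat.cast_pos.2 (hP p hp)) (hPu p hp)
  have hL100 : 100 ≤ L := by
    have h1 : exp 5 ≤ 2 / η := by
      have h2 : exp 5 = exp 1 ^ 5 := by rw [← exp_nat_mul]; norm_num
      have h3 : exp 1 ^ 5 ≤ 2.7182818286 ^ 5 := by gcongr; exact exp_one_lt_d9.le
      rw [h2, le_div_iff₀ hη]
      norm_num at h3
      nlinarith
    have := (le_log_iff_exp_le (by positivity)).2 h1
    linarith
  have hu0 : 50000 ≤ u := by
    refine le_trans ?_ hu
    rw [le_div_iff₀ hη2]
    nlinarith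
  -- With exponent sum `w`, the cutoffs `u = (1-8η)w` and `V = (1+6η)w` lie on either side of `w`,
  -- far enough out for a shift by `3η/L` to beat each tail.
  set w := u / (1 - 8 * η) with hw
  have h8 : 0 < 1 - 8 * η := by linarith
  have hwu : w * (1 - 8 * η) = u := div_mul_cancel₀ _ h8.ne'
  have huw : u ≤ w := by nlinarith
  have hw0 : 50000 ≤ w := hu0.trans huw
  have hwη : 5 ≤ w * η ^ 2 := by
    rw [div_le_iff₀ hη2] at hu
    nlinarith
  set B := ∑ p ∈ P, g p / p with hBdef
  have hB0 : 0 < B := hη2.trans_le hB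
  set ℒ := log (2 * u / η ^ 2) with hℒ
  have hℒL : ℒ ≤ 0.6 * L := by
    have h1 : log u ≤ L / 2 := by
      rw [hLdef, ← log_sqrt hz0.le]
      exact log_le_log (by linarith) huz
    rw [log_div two_ne_zero hη.ne'] at hηz
    rw [hℒ, log_div (by positivity) hη2.ne', log_mul two_ne_zero (by positivity), log_pow]
    have := log_pos (one_lt_two (α := ℝ))
    push_cast
    linarith
  have hwB : log (w / B) ≤ ℒ := by
    refine log_le_log (by positivity) ?_
    have : w ≤ 2 * u := by nlinarith
    gcongr
  have hwB0 : 25000 ≤ w / B := by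
    rw [le_div_iff₀ hB0]; linarith
  have hlogwB : 0 ≤ log (w / B) := log_nonneg (by linarith)
  have hη' : 0 < 1 - η := by linarith
  set Lam := log (w / B) / (1 - η) with hLam
  have hLam0 : 0 ≤ Lam := div_nonneg hlogwB hη'.le
  obtain ⟨lam, hlam10, hlamLam, hlamw⟩ :=
    exists_weightSum_eq hg hL hη' hPl' hPu' hB0 hB2 hw0
  change lam ≤ Lam at hlamLam
  have hlamL : lam ≤ 0.61 * L := by
    refine hlamLam.trans ?_
    rw [hLam, div_le_iff₀ hη']
    nlinarith
  set σ := 1 - lam / L with hσ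
  have hlamL' : lam / L ≤ 0.61 := (div_le_iff₀ hL).2 hlamL
  have hlamL0 : 0 < lam / L := by positivity
  set s : ℂ := ⟨σ, π / L⟩ with hs
  have hK : 1 / 2 * (L / lam) ≤ ‖mellin (fun x => ((Int.fract x : ℝ) : ℂ)) (-s)‖ :=
    half_le_norm_mellin_fract hz hL100 hlam10 hlamL
  have hG : exp ((1 - 6 * η ^ 2) * w) ≤ ‖∏ p ∈ P, (1 - (g p : ℂ) * (p : ℂ) ^ (-s))‖ := by
    rw [← hlamw]
    exact le_norm_prod_one_sub hP hg hg1 hL hη hη1 hPl' hPu' hlamL hηz rfl rfl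
  set V := w * (1 + 6 * η) with hV
  have hVY : V * lam ≤ u * (1 + 25 * η) * ℒ := by
    have h1 : V ≤ u * (1 + 25 * η) * (1 - η) := by
      rw [← hwu, hV, mul_assoc w, mul_assoc w]
      refine mul_le_mul_of_nonneg_left ?_ (by linarith)
      nlinarith [mul_pos hη hη, mul_pos hη (mul_pos hη hη)]
    calc V * lam ≤ V * Lam := by gcongr
      _ ≤ u * (1 + 25 * η) * (1 - η) * Lam := by gcongr
      _ = u * (1 + 25 * η) * log (w / B) := by rw [hLam]; field_simp
      _ ≤ _ := by gcongr
  have hV1 : V ≤ 1.2 * u := by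
    rw [← hwu, hV]
    nlinarith
  -- Chosen so that the range up to `z^V`, where `(z^V)^(1-σ) = exp(Vλ)`, contributes only `1/8` of
  -- `exp((1-6η²)w) L/λ`, against the main term's `1/2`.
  set ε := 1 / 8 * exp ((1 - 6 * η ^ 2) * w - V * lam) with hε
  have hεY : 1 / 8 * exp (-(u * (1 + 25 * η) * ℒ)) ≤ ε := by
    rw [hε]
    gcongr
    have : 0 ≤ (1 - 6 * η ^ 2) * w := mul_nonneg (by nlinarith) (by linarith)
    linarith
  obtain ⟨hw1, hw2⟩ := exp_weights_le hη hη1 hwη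
  obtain ⟨x, hx1, hx2, hx3⟩ : ∃ x, z ^ u ≤ x ∧ x ≤ z ^ V ∧ ε * x < |fractSum P g x| := by
    refine exists_lt_abs_fractSum (P := P) (g := g) hP hg (s := s)
      (κ₁ := 1 - (lam + -(3 * η)) / L) (κ₂ := 1 - (lam + 3 * η) / L) (A := z ^ u) (B := z ^ V) (ε := ε)
      (by change 0 < σ; linarith) (by change σ < 1; linarith)
      (by change σ ≤ _; rw [hσ]; gcongr; linarith)
      (by rw [sub_lt_self_iff]; exact div_pos (by linarith) hL)
      (by rw [sub_pos, div_lt_one hL]; linarith)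
      (by change _ ≤ σ; rw [hσ]; gcongr; linarith)
      (rpow_pos_of_pos hz0 _)
      (rpow_le_rpow_of_exponent_le hz.le (by rw [hV]; nlinarith))
      (by positivity) ?_
    change (z ^ u) ^ (1 - (lam + -(3 * η)) / L - σ) * _ + (z ^ V) ^ (1 - (lam + 3 * η) / L - σ) * _ +
      ε * ((z ^ V) ^ (1 - σ) / (1 - σ)) < _
    rw [mellin_fractSum hP (by change 0 < σ; linarith) (by change σ < 1; linarith), norm_mul]
    have hpow : ∀ a b : ℝ, (z ^ a) ^ b = exp (a * (b * L)) := fun a b => by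
      rw [← rpow_mul hz0.le, rpow_def_of_pos hz0, hLdef]
      ring_nf
    set E := exp ((1 - 6 * η ^ 2) * w) with hE
    have hE0 : 0 < E := exp_pos _
    have e1 : (z ^ u) ^ (1 - (lam + -(3 * η)) / L - σ) = exp (w * (1 - 8 * η) * (3 * η)) := by
      rw [hpow, hwu, hσ]
      congr 2
      field_simp
      ring
    have e2 : (z ^ V) ^ (1 - (lam + 3 * η) / L - σ) = exp (-(w * (1 + 6 * η) * (3 * η))) := by
      rw [hpow, ← hV, hσ, ← mul_neg]
      congr 2
      field_simp
      ring
    have e3 : ε * ((z ^ V) ^ (1 - σ) / (1 - σ)) = 1 / 8 * E * (L / lam) := by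
      have : V * ((1 - (1 - lam / L)) * L) = V * lam := by field_simp; ring
      rw [hpow, hε, hσ, exp_sub, ← hE, this, sub_sub_cancel]
      field_simp
    rw [e1, e2, e3]
    have t1 := tail_le hP hg hL100 hlam10 hlamL (ν := -(3 * η))
      (a := w * (1 - 8 * η) * (3 * η)) (b := exp (-15) * E)
      (by rw [abs_neg, abs_of_pos (by linarith)]; linarith)
      (fun p hp => mul_le_mul_of_nonpos_left ((le_div_iff₀ hL).2 (hPl' p hp)) (by linarith))
      (by rw [hlamw]; exact hw1)
    have t2 := tail_le hP hg hL100 hlam10 hlamL (ν := 3 * η)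
      (a := -(w * (1 + 6 * η) * (3 * η))) (b := exp (-15) * E)
      (by rw [abs_of_pos (by linarith)]; linarith)
      (fun p hp => mul_le_of_le_one_right (by linarith) ((div_le_one hL).2 (hPu' p hp)))
      (by rw [hlamw]; exact hw2)
    have hq0 : 0 < L / lam := by positivity
    have hmain : 1 / 2 * (L / lam) * E ≤ ‖mellin (fun x => ((Int.fract x : ℝ) : ℂ)) (-s)‖ *
        ‖∏ p ∈ P, (1 - (g p : ℂ) * (p : ℂ) ^ (-s))‖ :=
      mul_le_mul hK hG hE0.le (norm_nonneg _)
    refine lt_of_lt_of_le ?_ hmain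
    have h15 : exp (-15) * E ≤ 1 / 100 * E := by gcongr; exact exp_neg_fifteen_lt.le
    have h16 : 3 * (L / lam) * (exp (-15) * E) ≤ 3 * (L / lam) * (1 / 100 * E) := by gcongr
    have h17 : 0 < L / lam * E := by positivity
    linarith
  refine ⟨x, hx1, hx2.trans (rpow_le_rpow_of_exponent_le hz.le hV1), lt_of_le_of_lt ?_ hx3⟩
  have : 0 ≤ x := (rpow_nonneg hz0.le _).trans hx1
  gcongr

end

/-! ### Maier's matrix and the functions `f_q`, `γ_q` for squarefree `q`. -/

section

open Finset

namespace ArithSeq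

theorem factor_pos {h : ℝ} (h1 : h ≤ 1) {p : ℕ} (hp : p.Prime) : 0 < 1 - h / p := by
  have hp1 : (1 : ℝ) < p := Nat.one_lt_cast.2 hp.one_lt
  rw [sub_pos, div_lt_one (by linarith)]
  linarith

/-- `1 - f_q(p)` for a prime `p` exactly dividing `q`. -/
noncomputable def defect (h : ℕ → ℝ) (p : ℕ) : ℝ := (1 - h p) / (1 - h p / p)

theorem fq_prod_primes {h : ℕ → ℝ} (hone : h 1 = 1) (hle : ∀ n, h n ≤ 1) {P : Finset ℕ}
    (hP : ∀ p ∈ P, p.Prime) (b : ℕ) :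
    fq h (∏ p ∈ P, p) b = ∏ p ∈ P, if p ∣ b then 1 - defect h p else 1 := by
  have hq : ∏ p ∈ P, p ≠ 0 := prod_ne_zero_iff.2 fun p hp => (hP p hp).ne_zero
  rw [fq, Nat.primeFactors_prod hP]
  refine prod_congr rfl fun p hp => ?_
  have hpp := hP p hp
  have hpos := factor_pos (hle p) hpp
  have he : (∏ p ∈ P, p).factorization p = 1 := by
    rw [Nat.factorization_prod fun r hr => (hP r hr).ne_zero, sum_congr rfl fun r hr =>
      (hP r hr).factorization, Finsupp.finsetSum_apply]
    simp [Finsupp.single_apply, hp]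
  rw [he, localFactor]
  have hg : Nat.gcd b (∏ p ∈ P, p) ≠ 0 := Nat.gcd_ne_zero_right hq
  have hdvd : p ∣ Nat.gcd b (∏ p ∈ P, p) ↔ p ∣ b :=
    ⟨fun h => h.trans (Nat.gcd_dvd_left _ _), fun h => Nat.dvd_gcd h (dvd_prod_of_mem _ hp)⟩
  have hk : (Nat.gcd b (∏ p ∈ P, p)).factorization p < 1 ↔ ¬ p ∣ b := by
    rw [← hdvd, hpp.dvd_iff_one_le_factorization hg, not_le]
  have hp0 : (p : ℝ) ≠ 0 := Nat.cast_ne_zero.2 hpp.ne_zero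
  by_cases hb : p ∣ b
  · rw [if_neg (by rw [hk, not_not]; exact hb), if_pos hb, defect, pow_one, ← div_eq_mul_inv,
      one_sub_div hpos.ne']
    congr 1
    field_simp
    ring
  · have hk' := hk.2 hb
    rw [if_pos hk', if_neg hb, Nat.lt_one_iff.1 hk', pow_zero, zero_add, pow_one, hone,
      mul_inv_cancel₀ hpos.ne']

theorem gammaq_prod_primes {h : ℕ → ℝ} (hle : ∀ n, h n ≤ 1) {P : Finset ℕ}
    (hP : ∀ p ∈ P, p.Prime) : gammaq h (∏ p ∈ P, p) = ∏ p ∈ P, (1 - defect h p / p) := by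
  rw [gammaq, Nat.primeFactors_prod hP]
  refine prod_congr rfl fun p hp => ?_
  have hpos := factor_pos (hle p) (hP p hp)
  have hp0 : (p : ℝ) ≠ 0 := Nat.cast_ne_zero.2 (hP p hp).ne_zero
  rw [inv_div, defect, div_eq_iff hpos.ne', sub_mul, one_mul, div_mul_eq_mul_div,
    div_mul_cancel₀ _ hpos.ne']
  ring

/-- The middle bound turns the hypothesis on `∑ (1 - h(p))/p` into a lower bound for `∑ g(p)/p`. -/
theorem defect_bounds {h : ℕ → ℝ} (h0 : ∀ n, 0 ≤ h n) (hle : ∀ n, h n ≤ 1) {p : ℕ}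
    (hp : p.Prime) : 0 ≤ defect h p ∧ 1 - h p ≤ defect h p ∧ defect h p ≤ 1 := by
  have hpos := factor_pos (hle p) hp
  have hp1 : (1 : ℝ) ≤ p := Nat.one_le_cast.2 hp.one_le
  have h1 : h p / p ≤ h p := div_le_self (h0 p) hp1
  have h2 : 0 ≤ h p / p := div_nonneg (h0 p) (by linarith)
  have h3 := hle p
  refine ⟨div_nonneg (by linarith) hpos.le, ?_, (div_le_one hpos).2 (by linarith)⟩
  rw [defect, le_div_iff₀ hpos]
  nlinarith

theorem abs_totalAP_sub_le {a : ℕ → ℝ} (h : ℕ → ℝ) (ha : ∀ n, 0 ≤ a n) {x : ℝ} (hx : 0 < x)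
    (hA : 0 < total a x) {d : ℕ} (hd : 0 < d) {y : ℝ} (hy : x / 4 ≤ y) (hyx : y ≤ x) (b : ℕ) :
    |totalAP a y d b - fq h d b / (d * gammaq h d) * (y / x) * total a x| ≤
      Delta a h x d * (total a x / Nat.totient d) := by
  have hφ : (0 : ℝ) < Nat.totient d := Nat.cast_pos.2 (Nat.totient_pos.2 hd)
  rw [← div_le_iff₀ (div_pos hA hφ)]
  exact le_csSup (discrepancySet_nonempty_bddAbove a h ha hx hd.ne').2 ⟨y, ⟨hy, hyx⟩, b, rfl⟩

theorem totalAP_sub_totalAP (a : ℕ → ℝ) {d : ℕ} (hd : 0 < d) (c : ℕ) {m n : ℕ} (hmn : m ≤ n) :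
    totalAP a ((c + n * d : ℕ) : ℝ) d c - totalAP a ((c + m * d : ℕ) : ℝ) d c =
      ∑ k ∈ Ioc m n, a (c + k * d) := by
  have himg : ((Ioc (c + m * d) (c + n * d)).filter fun i => i ≡ c [MOD d]) =
      (Ioc m n).image fun k => c + k * d := by
    ext i
    simp only [mem_filter, mem_Ioc, mem_image]
    constructor
    · rintro ⟨⟨h1, h2⟩, h3⟩
      obtain ⟨k, hk⟩ := (Nat.modEq_iff_dvd' (by nlinarith : c ≤ i)).1 h3.symm
      have hi : i = c + k * d := by rw [mul_comm k, ← hk]; omega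
      subst hi
      exact ⟨k, ⟨lt_of_mul_lt_mul_right (by omega : m * d < k * d) hd.le,
        le_of_mul_le_mul_right (by omega : k * d ≤ n * d) hd⟩, rfl⟩
    · rintro ⟨k, ⟨h1, h2⟩, rfl⟩
      refine ⟨⟨?_, ?_⟩, ?_⟩
      · have := mul_lt_mul_of_pos_right h1 hd; omega
      · have := Nat.mul_le_mul_right d h2; omega
      · simp [Nat.ModEq]
  have hle : c + m * d ≤ c + n * d := by gcongr
  have hunion : Icc 1 (c + n * d) = Icc 1 (c + m * d) ∪ Ioc (c + m * d) (c + n * d) := by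
    ext i; simp only [mem_union, mem_Icc, mem_Ioc]; omega
  have hdisj : Disjoint (Icc 1 (c + m * d)) (Ioc (c + m * d) (c + n * d)) := by
    rw [disjoint_left]
    intro i; simp only [mem_Icc, mem_Ioc]; omega
  rw [totalAP, totalAP, Nat.floor_natCast, Nat.floor_natCast, hunion, filter_union,
    sum_union (disjoint_filter_filter hdisj), add_sub_cancel_left, himg, sum_image]
  intro i _ j _ hij
  exact Nat.eq_of_mul_eq_mul_right hd (Nat.add_left_cancel hij)

/-- Subtract the estimates at two cutoffs lying in the progression itself, so that no rounding
occurs; both must be in `[x/4, x]`, where `Δ_d` has control. -/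
theorem abs_sum_progression_sub_le {a : ℕ → ℝ} (h : ℕ → ℝ) (ha : ∀ n, 0 ≤ a n) {x : ℝ}
    (hx : 0 < x) (hA : 0 < total a x) {d : ℕ} (hd : 0 < d) (c : ℕ) {m n : ℕ} (hmn : m ≤ n)
    (h1 : x / 4 ≤ ((c + m * d : ℕ) : ℝ)) (h2 : ((c + n * d : ℕ) : ℝ) ≤ x) :
    |∑ k ∈ Ioc m n, a (c + k * d) -
        fq h d c / gammaq h d * (((n : ℝ) - m) / x * total a x)| ≤
      2 * (Delta a h x d * (total a x / Nat.totient d)) := by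
  have hle : ((c + m * d : ℕ) : ℝ) ≤ ((c + n * d : ℕ) : ℝ) := by
    exact_mod_cast Nat.add_le_add_left (Nat.mul_le_mul_right d hmn) c
  have e1 := abs_totalAP_sub_le h ha hx hA hd (h1.trans hle) h2 c
  have e2 := abs_totalAP_sub_le h ha hx hA hd h1 (hle.trans h2) c
  have hd0 : (d : ℝ) ≠ 0 := Nat.cast_ne_zero.2 hd.ne'
  rw [← totalAP_sub_totalAP a hd c hmn, two_mul]
  refine le_trans (le_of_eq ?_) ((abs_sub _ _).trans (add_le_add e1 e2))
  congr 1
  have : fq h d c / gammaq h d * (((n : ℝ) - m) / x * total a x) =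
      fq h d c / (d * gammaq h d) * (((c + n * d : ℕ) : ℝ) / x) * total a x -
        fq h d c / (d * gammaq h d) * (((c + m * d : ℕ) : ℝ) / x) * total a x := by
    push_cast
    rcases eq_or_ne (gammaq h d) 0 with hγ | hγ
    · simp [hγ]
    · field_simp
      ring
  rw [this]
  ring

/-- Maier's matrix method: summing `a (r q + s ℓ)` by rows and by columns compares the mean
values of `f_q` and `f_ℓ`. -/
theorem maier_matrix {a : ℕ → ℝ} (h : ℕ → ℝ) (ha : ∀ n, 0 ≤ a n) {x : ℝ}
    (hx : 0 < x) (hA : 0 < total a x) {q l : ℕ} (hq : 0 < q) (hl : 0 < l) {N m n : ℕ}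
    (hmn : m ≤ n) (h1 : x / 4 ≤ m * q) (h2 : (n : ℝ) * q + N * l ≤ x) :
    |((n : ℝ) - m) * ((∑ s ∈ Ioc 0 N, fq h q (s * l)) / gammaq h q) -
        N * ((∑ r ∈ Ioc m n, fq h l (r * q)) / gammaq h l)| ≤
      2 * x * (N * (Delta a h x q / Nat.totient q) +
        ((n : ℝ) - m) * (Delta a h x l / Nat.totient l)) := by
  set T := total a x
  set M := ∑ s ∈ Ioc 0 N, ∑ r ∈ Ioc m n, a (s * l + r * q) with hM
  -- Columns: with `s` fixed, the entries run through the class of `sl` mod `q`.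
  have hcol : |M - ((n : ℝ) - m) * ((∑ s ∈ Ioc 0 N, fq h q (s * l)) / gammaq h q) * (T / x)| ≤
      N * (2 * (Delta a h x q * (T / Nat.totient q))) := by
    have : M - ((n : ℝ) - m) * ((∑ s ∈ Ioc 0 N, fq h q (s * l)) / gammaq h q) * (T / x) =
        ∑ s ∈ Ioc 0 N, (∑ r ∈ Ioc m n, a (s * l + r * q) -
          fq h q (s * l) / gammaq h q * (((n : ℝ) - m) / x * T)) := by
      rw [sum_sub_distrib, ← hM, ← sum_mul, ← sum_div]
      ring
    rw [this]
    refine (abs_sum_le_sum_abs _ _).trans ((sum_le_card_nsmul _ _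
      (2 * (Delta a h x q * (T / Nat.totient q))) fun s hs => ?_).trans_eq ?_)
    · refine abs_sum_progression_sub_le h ha hx hA hq (s * l) hmn ?_ ?_
      · push_cast
        have : (0 : ℝ) ≤ s * l := by positivity
        linarith
      · have : (s : ℝ) * l ≤ N * l := by
          have : (s : ℝ) ≤ N := Nat.cast_le.2 (mem_Ioc.1 hs).2
          gcongr
        push_cast
        linarith
    · rw [Nat.card_Ioc, Nat.sub_zero, nsmul_eq_mul]
  -- Rows: with `r` fixed, the entries run through the class of `rq` mod `l`.
  have hrow : |M - N * ((∑ r ∈ Ioc m n, fq h l (r * q)) / gammaq h l) * (T / x)| ≤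
      ((n : ℝ) - m) * (2 * (Delta a h x l * (T / Nat.totient l))) := by
    have : M - N * ((∑ r ∈ Ioc m n, fq h l (r * q)) / gammaq h l) * (T / x) =
        ∑ r ∈ Ioc m n, (∑ s ∈ Ioc 0 N, a (r * q + s * l) -
          fq h l (r * q) / gammaq h l * (((N : ℝ) - (0 : ℕ)) / x * T)) := by
      rw [sum_sub_distrib, hM, sum_comm, ← sum_mul, ← sum_div]
      simp_rw [add_comm (_ * l)]
      push_cast
      ring
    rw [this]
    refine (abs_sum_le_sum_abs _ _).trans ((sum_le_card_nsmul _ _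
      (2 * (Delta a h x l * (T / Nat.totient l))) fun r hr => ?_).trans_eq ?_)
    · obtain ⟨hr1, hr2⟩ := mem_Ioc.1 hr
      refine abs_sum_progression_sub_le h ha hx hA hl (r * q) (Nat.zero_le N) ?_ ?_
      · have : (m : ℝ) * q ≤ r * q := by
          have : (m : ℝ) ≤ r := Nat.cast_le.2 hr1.le
          gcongr
        push_cast
        linarith
      · have : (r : ℝ) * q ≤ n * q := by
          have : (r : ℝ) ≤ n := Nat.cast_le.2 hr2
          gcongr
        push_cast
        linarith
    · rw [Nat.card_Ioc, nsmul_eq_mul, Nat.cast_sub hmn]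
  have hT : 0 < T / x := div_pos hA hx
  refine le_of_mul_le_mul_right ?_ hT
  rw [← abs_of_pos hT, ← abs_mul, abs_of_pos hT, sub_mul]
  rw [abs_sub_comm] at hcol
  refine (abs_sub_le _ M _).trans ((add_le_add hcol hrow).trans_eq ?_)
  field_simp

theorem div_totient_prod_primes_le {P : Finset ℕ} (hP : ∀ p ∈ P, p.Prime) :
    ((∏ p ∈ P, p : ℕ) : ℝ) / Nat.totient (∏ p ∈ P, p) ≤ Real.exp (2 * ∑ p ∈ P, 1 / (p : ℝ)) := by
  have hq : 0 < ∏ p ∈ P, p := prod_pos fun p hp => (hP p hp).pos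
  have hφ := Nat.totient_mul_prod_primeFactors (∏ p ∈ P, p)
  rw [Nat.primeFactors_prod hP] at hφ
  have hφ' : Nat.totient (∏ p ∈ P, p) = ∏ p ∈ P, (p - 1) :=
    Nat.eq_of_mul_eq_mul_right hq (hφ.trans (mul_comm _ _))
  rw [hφ', Nat.cast_prod, Nat.cast_prod, ← prod_div_distrib, mul_sum, Real.exp_sum]
  refine prod_le_prod (fun _ _ => by positivity) fun p hp => ?_
  have hp2 : (2 : ℝ) ≤ p := by exact_mod_cast (hP p hp).two_le
  rw [Nat.cast_pred (hP p hp).pos]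
  refine le_trans ?_ (Real.add_one_le_exp _)
  rw [div_le_iff₀ (by linarith)]
  have : 2 * (1 / (p : ℝ)) * p = 2 := by field_simp
  have h1 : 2 * (1 / (p : ℝ)) ≤ 1 := by
    rw [mul_one_div]; exact (div_le_one (by linarith)).2 hp2
  linarith

end ArithSeq

end

/-! ### From a large remainder to a large discrepancy. -/

section

open Finset

namespace ArithSeq

theorem Delta_nonneg {a : ℕ → ℝ} (h : ℕ → ℝ) {x : ℝ} (hA : 0 < total a x) (d : ℕ) :
    0 ≤ Delta a h x d := by
  refine Real.sSup_nonneg ?_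
  rintro r ⟨y, -, b, rfl⟩
  exact div_nonneg (abs_nonneg _) (div_nonneg hA.le (Nat.cast_nonneg _))

theorem gammaq_bounds {h : ℕ → ℝ} (h0 : ∀ n, 0 ≤ h n) (hle : ∀ n, h n ≤ 1) {P : Finset ℕ}
    (hP : ∀ p ∈ P, p.Prime) :
    0 < ∏ p ∈ P, (1 - defect h p / p) ∧ ∏ p ∈ P, (1 - defect h p / p) ≤ 1 := by
  have key : ∀ p ∈ P, 0 < 1 - defect h p / p ∧ 1 - defect h p / p ≤ 1 := fun p hp => by
    obtain ⟨h1, -, h2⟩ := defect_bounds h0 hle (hP p hp)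
    refine ⟨factor_pos h2 (hP p hp), ?_⟩
    have : 0 ≤ defect h p / p := div_nonneg h1 (Nat.cast_nonneg _)
    linarith
  exact ⟨prod_pos fun p hp => (key p hp).1,
    prod_le_one (fun p hp => (key p hp).1.le) fun p hp => (key p hp).2⟩

/-- For a large prime `l` the mean value of `f_l`, divided by `γ_l`, is close to `1`. -/
theorem abs_mean_fq_prime_sub_le {h : ℕ → ℝ} (hone : h 1 = 1) (h0 : ∀ n, 0 ≤ h n)
    (hle : ∀ n, h n ≤ 1) {l q : ℕ} (hl : l.Prime) (hlq : ¬ l ∣ q) {m n : ℕ} (hmn : m ≤ n)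
    (hn : (n : ℝ) ≤ 3 * ((n : ℝ) - m)) :
    |((n : ℝ) - m) - (∑ r ∈ Ioc m n, fq h l (r * q)) / gammaq h l| ≤ ((n : ℝ) - m) * (4 / l) := by
  have hP : ∀ p ∈ ({l} : Finset ℕ), p.Prime := fun p hp => by rwa [mem_singleton.1 hp]
  obtain ⟨hd0, -, hd1⟩ := defect_bounds h0 hle hl
  have hl2 : (2 : ℝ) ≤ l := by exact_mod_cast hl.two_le
  have hf : ∀ r, fq h l (r * q) = if l ∣ r then 1 - defect h l else 1 := fun r => by
    have := fq_prod_primes hone hle hP (r * q)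
    rw [prod_singleton, prod_singleton] at this
    rw [this]
    exact if_congr ⟨fun hd => (hl.dvd_mul.1 hd).resolve_right hlq, fun hd => hd.mul_right q⟩ rfl rfl
  have hγ : gammaq h l = 1 - defect h l / l := by
    have := gammaq_prod_primes hle hP
    rwa [prod_singleton, prod_singleton] at this
  set K : ℝ := (n : ℝ) - m with hK
  have hK0 : 0 ≤ K := sub_nonneg.2 (Nat.cast_le.2 hmn)
  have hcard : ((Ioc m n).card : ℝ) = K := by rw [Nat.card_Ioc, Nat.cast_sub hmn]
  set S := ∑ r ∈ Ioc m n, fq h l (r * q) with hS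
  have hSu : S ≤ K := by
    calc S ≤ ∑ r ∈ Ioc m n, (1 : ℝ) := by
          refine sum_le_sum fun r _ => ?_
          rw [hf]
          split_ifs <;> linarith
      _ = K := by rw [sum_const, nsmul_eq_mul, mul_one, hcard]
  -- Only multiples of `l` can lower the sum, and there are at most `n/l ≤ 3K/l` of them.
  have hSl : K - 3 * K / l ≤ S := by
    have h1 : K - ((Ioc m n).filter (l ∣ ·)).card ≤ S := by
      calc K - ((Ioc m n).filter (l ∣ ·)).card
          = ∑ r ∈ Ioc m n, ((1 : ℝ) - if l ∣ r then 1 else 0) := by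
            rw [sum_sub_distrib, sum_const, nsmul_eq_mul, mul_one, hcard, sum_boole]
        _ ≤ S := by
            refine sum_le_sum fun r _ => ?_
            rw [hf]
            split_ifs <;> linarith
    have h2 : (((Ioc m n).filter (l ∣ ·)).card : ℝ) ≤ n / l := by
      have h3 : ((Ioc m n).filter (l ∣ ·)).card ≤ n / l := by
        rw [← Nat.Ioc_filter_dvd_card_eq_div]
        exact card_le_card (filter_subset_filter _ (Ioc_subset_Ioc_left (Nat.zero_le m)))
      exact (Nat.cast_le.2 h3).trans Nat.cast_div_le
    have h4 : (n : ℝ) / l ≤ 3 * K / l := by gcongr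
    linarith
  have hinv0 : 0 < 1 / (l : ℝ) := by positivity
  have hinv2 : 1 / (l : ℝ) ≤ 1 / 2 := one_div_le_one_div_of_le two_pos hl2
  have hγl : 1 - 1 / (l : ℝ) ≤ gammaq h l := by
    rw [hγ]; gcongr
  have hγu : gammaq h l ≤ 1 := by
    rw [hγ, sub_le_self_iff]; positivity
  have hγ0 : 0 < gammaq h l := by linarith
  have h3K : 3 * K / l = 3 * K * (1 / l) := by ring
  have h4K : 4 / (l : ℝ) = 4 * (1 / l) := by ring
  have hup : S / gammaq h l ≤ K + K * (4 / l) := by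
    rw [div_le_iff₀ hγ0]
    have : K ≤ (K + K * (4 / l)) * (1 - 1 / l) := by
      rw [h4K]
      nlinarith [mul_nonneg hK0 hinv0.le]
    refine hSu.trans (this.trans ?_)
    have : 0 ≤ K + K * (4 / l) := by positivity
    gcongr
  have hlow : K - K * (4 / l) ≤ S / gammaq h l := by
    rcases le_total 0 S with hS0 | hS0
    · have : S ≤ S / gammaq h l := le_div_self hS0 hγ0 hγu
      rw [h4K]
      nlinarith [mul_nonneg hK0 hinv0.le]
    · have hS2 : 0 ≤ S := by
        refine sum_nonneg fun r _ => ?_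
        rw [hf]
        split_ifs <;> linarith
      have hS3 : S = 0 := le_antisymm hS0 hS2
      rw [hS3, zero_div]
      rw [hS3, h3K] at hSl
      rw [h4K]
      nlinarith [mul_nonneg hK0 hinv0.le]
  rw [abs_le]
  constructor <;> linarith

theorem exp_four_le : Real.exp 4 ≤ 60 := by
  have h : Real.exp 4 = Real.exp 1 ^ 4 := by rw [← Real.exp_nat_mul]; norm_num
  rw [h]
  calc Real.exp 1 ^ 4 ≤ 2.7182818286 ^ 4 := by
        gcongr
        exact Real.exp_one_lt_d9.le
    _ ≤ 60 := by norm_num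

/-- A large deviation of the mean value of `f_q` forces a large discrepancy, to the modulus `q` or
to an auxiliary prime modulus `l`. -/
theorem abs_fractSum_le_Delta {a h : ℕ → ℝ} (ha : ∀ n, 0 ≤ a n) (hone : h 1 = 1)
    (h0 : ∀ n, 0 ≤ h n) (hle : ∀ n, h n ≤ 1) {x : ℝ} (hx : 0 < x) (hA : 0 < total a x)
    {P : Finset ℕ} (hP : ∀ p ∈ P, p.Prime) (hsum : ∑ p ∈ P, 1 / (p : ℝ) ≤ 2) {l N : ℕ}
    (hl : l.Prime) (hlP : l ∉ P) (hN : 0 < N) (hlN : (l : ℝ) * N ≤ x / 4)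
    (hlN' : x / 8 ≤ (l : ℝ) * N) (hqx : 8 * ((∏ p ∈ P, p : ℕ) : ℝ) ≤ x) :
    |fractSum P (defect h) N| ≤
      N * (4 / l + 480 * Delta a h x (∏ p ∈ P, p) + 32 * Delta a h x l) := by
  set q := ∏ p ∈ P, p with hqdef
  have hq : 0 < q := prod_pos fun p hp => (hP p hp).pos
  have hq0 : (0 : ℝ) < q := Nat.cast_pos.2 hq
  have hN0 : (0 : ℝ) < N := Nat.cast_pos.2 hN
  have hl2 : (2 : ℝ) ≤ l := by exact_mod_cast hl.two_le
  set X := x / q with hX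
  have hX8 : 8 ≤ X := (le_div_iff₀ hq0).2 hqx
  have hXq : X * q = x := div_mul_cancel₀ _ hq0.ne'
  -- With `rq` between `x/4` and `3x/4` and `lN ≤ x/4`, every entry lies in `[x/4, x]`. `X ≥ 8`
  -- absorbs the rounding and leaves at least `X/4` rows.
  set m := ⌈X / 4⌉₊ with hm
  set n := ⌊3 * X / 4⌋₊ with hn
  have hm1 : X / 4 ≤ m := Nat.le_ceil _
  have hm2 : (m : ℝ) < X / 4 + 1 := Nat.ceil_lt_add_one (by linarith)
  have hn1 : (n : ℝ) ≤ 3 * X / 4 := Nat.floor_le (by linarith)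
  have hn2 : 3 * X / 4 < n + 1 := Nat.lt_floor_add_one _
  set K : ℝ := (n : ℝ) - m with hK
  have hKX : X / 4 ≤ K := by linarith
  have hK0 : 0 < K := by linarith
  have hmn : m ≤ n := by
    have : (m : ℝ) ≤ n := by linarith
    exact_mod_cast this
  have hlq : ¬ l ∣ q := fun hd => by
    obtain ⟨p, hp, hlp⟩ := (hl.prime.dvd_finsetProd_iff _).1 hd
    exact hlP (by rwa [(Nat.prime_dvd_prime_iff_eq hl (hP p hp)).1 hlp])
  have hmat := maier_matrix h ha hx hA hq hl.pos (N := N) hmn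
    (by nlinarith) (by nlinarith)
  have hprime := abs_mean_fq_prime_sub_le hone h0 hle hl hlq hmn (by linarith)
  set γ := ∏ p ∈ P, (1 - defect h p / p) with hγ
  obtain ⟨hγ0, hγ1⟩ := gammaq_bounds h0 hle hP
  have hmean : (∑ s ∈ Ioc 0 N, fq h q (s * l)) / gammaq h q =
      N - fractSum P (defect h) N / γ := by
    have h1 := sum_prod_ite_dvd hP (defect h) (x := N) hN0.le
    rw [Nat.floor_natCast] at h1
    have h2 : ∑ s ∈ Ioc 0 N, fq h q (s * l) =
        ∑ s ∈ Icc 1 N, ∏ p ∈ P, (if p ∣ s then 1 - defect h p else 1) := by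
      refine sum_congr rfl fun s _ => ?_
      rw [hqdef, fq_prod_primes hone hle hP]
      -- `l` is a prime outside `P`, so multiplying by `l` does not affect divisibility by the
      -- primes of `q`.
      refine prod_congr rfl fun p hp => if_congr ⟨fun hd => ?_, fun hd => hd.mul_right l⟩ rfl rfl
      refine ((hP p hp).dvd_mul.1 hd).resolve_right fun hpl => hlP ?_
      rwa [← (Nat.prime_dvd_prime_iff_eq (hP p hp) hl).1 hpl]
    rw [h2, h1, hqdef, gammaq_prod_primes hle hP, sub_div, mul_div_cancel_right₀ _ hγ0.ne']
  rw [hmean] at hmat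
  set D := fractSum P (defect h) N with hD
  set Sl := (∑ r ∈ Ioc m n, fq h l (r * q)) / gammaq h l with hSl
  set Dq := Delta a h x q with hDq
  set Dl := Delta a h x l with hDl
  have hDq0 : 0 ≤ Dq := Delta_nonneg h hA q
  have hDl0 : 0 ≤ Dl := Delta_nonneg h hA l
  have hφq : (0 : ℝ) < Nat.totient q := Nat.cast_pos.2 (Nat.totient_pos.2 hq)
  have h60 : (q : ℝ) ≤ 60 * Nat.totient q := by
    rw [← div_le_iff₀ hφq]
    refine (div_totient_prod_primes_le hP).trans (le_trans (Real.exp_le_exp.2 ?_) exp_four_le)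
    linarith
  have hφl : ((Nat.totient l : ℕ) : ℝ) = l - 1 := by
    rw [Nat.totient_prime hl, Nat.cast_pred hl.pos]
  -- `480 = 2 · 4 · 60`: the factor `2` of the matrix bound, then `x ≤ 4Kq` and `q ≤ 60 φ(q)`.
  have e1 : 2 * x * (N * (Dq / Nat.totient q)) ≤ K * N * (480 * Dq) := by
    have : x * (1 / Nat.totient q) ≤ 240 * K := by
      rw [mul_one_div, div_le_iff₀ hφq]
      calc x = X * q := hXq.symm
        _ ≤ (4 * K) * (60 * Nat.totient q) := by gcongr; linarith
        _ = _ := by ring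
    calc 2 * x * (N * (Dq / Nat.totient q)) = x * (1 / Nat.totient q) * (2 * N * Dq) := by ring
      _ ≤ 240 * K * (2 * N * Dq) := by gcongr
      _ = _ := by ring
  -- `32 = 2 · 8 · 2`: the factor `2` of the matrix bound, then `x ≤ 8lN` and `l ≤ 2(l-1)`.
  have e2 : 2 * x * (K * (Dl / Nat.totient l)) ≤ K * N * (32 * Dl) := by
    have : x * (1 / Nat.totient l) ≤ 16 * N := by
      rw [hφl, mul_one_div, div_le_iff₀ (by linarith)]
      nlinarith
    calc 2 * x * (K * (Dl / Nat.totient l)) = x * (1 / Nat.totient l) * (2 * K * Dl) := by ring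
      _ ≤ 16 * N * (2 * K * Dl) := by gcongr
      _ = _ := by ring
  have e3 : |N * K - N * Sl| ≤ N * (K * (4 / l)) := by
    rw [← mul_sub, abs_mul, abs_of_pos hN0]
    gcongr
  have e4 : K * |D| ≤ |K * (N - D / γ) - N * K| := by
    have : K * (N - D / γ) - N * K = -(K * (D / γ)) := by ring
    rw [this, abs_neg, abs_mul, abs_of_pos hK0, abs_div, abs_of_pos hγ0]
    gcongr
    exact le_div_self (abs_nonneg _) hγ0 hγ1
  have e5 := abs_sub_le (K * (N - D / γ)) (N * Sl) (N * K)
  rw [abs_sub_comm (N * Sl) (N * K)] at e5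
  refine le_of_mul_le_mul_left ?_ hK0
  calc K * |D| ≤ 2 * x * (N * (Dq / Nat.totient q) + K * (Dl / Nat.totient l)) +
        N * (K * (4 / l)) := by linarith
    _ ≤ K * N * (480 * Dq) + K * N * (32 * Dl) + N * (K * (4 / l)) := by
        rw [mul_add]; linarith
    _ = _ := by ring

end ArithSeq

end

/-! ### Choice of parameters and conclusion. -/

open Finset Real

/-- The summatory function is constant on `[⌊x⌋, x]`, so the remainder changes only by `(x - ⌊x⌋)
γ_q ≤ 1`. -/
theorem abs_fractSum_floor_sub_le {P : Finset ℕ} {h : ℕ → ℝ} (h0 : ∀ n, 0 ≤ h n)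
    (hle : ∀ n, h n ≤ 1) (hP : ∀ p ∈ P, p.Prime) {x : ℝ} (hx : 0 ≤ x) :
    |fractSum P (ArithSeq.defect h) x| ≤ |fractSum P (ArithSeq.defect h) ⌊x⌋₊| + 1 := by
  obtain ⟨hγ0, hγ1⟩ := ArithSeq.gammaq_bounds h0 hle hP
  have h1 := sum_prod_ite_dvd hP (ArithSeq.defect h) hx
  have h2 := sum_prod_ite_dvd hP (ArithSeq.defect h) (x := ⌊x⌋₊) (Nat.cast_nonneg _)
  rw [Nat.floor_natCast] at h2
  set γ := ∏ p ∈ P, (1 - ArithSeq.defect h p / p)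
  have h3 : fractSum P (ArithSeq.defect h) x =
      fractSum P (ArithSeq.defect h) ⌊x⌋₊ + (x - ⌊x⌋₊) * γ := by linarith
  have h4 : 0 ≤ x - ⌊x⌋₊ := sub_nonneg.2 (Nat.floor_le hx)
  have h5 : x - ⌊x⌋₊ ≤ 1 := by linarith [Nat.lt_floor_add_one x]
  rw [h3]
  refine (abs_add_le _ _).trans (add_le_add_right ?_ _)
  rw [abs_mul, abs_of_nonneg h4, abs_of_pos hγ0]
  exact mul_le_one₀ h5 hγ0.le hγ1

/-- The choice of parameters: `z` exceeds a large power of `log log x`. -/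
theorem parameter_bounds {x η z : ℝ} (hx : exp (exp (exp 1)) ≤ x)
    (hη : 20 * log (log (log x)) / log (log x) ≤ η) (hη1 : η < 1 / 100) (hz : log x ^ η ≤ z) :
    0 < η ∧ 1 < z ∧ log (2 / η) ≤ log z / 20 ∧ log (log x) < z ^ (1 - η) ∧ 100 ≤ log z := by
  have hx0 : 0 < x := (exp_pos _).trans_le hx
  have hl1 : exp (exp 1) ≤ log x := (le_log_iff_exp_le hx0).2 hx
  have hl1' : 0 < log x := (exp_pos _).trans_le hl1
  have hl2 : exp 1 ≤ log (log x) := (le_log_iff_exp_le hl1').2 hl1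
  have hl2' : 0 < log (log x) := (exp_pos _).trans_le hl2
  have hl3 : 1 ≤ log (log (log x)) := (le_log_iff_exp_le hl2').2 hl2
  set l2 := log (log x)
  set l3 := log l2 with hl3def
  have hη0 : 0 < η := lt_of_lt_of_le (by positivity) hη
  have hηl : 20 * l3 ≤ η * l2 := (div_le_iff₀ hl2').1 hη
  have hz0 : 0 < z := (rpow_pos_of_pos hl1' _).trans_le hz
  have hlz : 20 * l3 ≤ log z := by
    refine hηl.trans ?_
    rw [← log_rpow hl1']
    exact log_le_log (rpow_pos_of_pos hl1' _) hz
  have hlogη : log (2 / η) ≤ log z / 20 := by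
    have : log (2 / η) ≤ l3 := by
      refine log_le_log (by positivity) ?_
      rw [div_le_iff₀ hη0]
      linarith
    linarith
  refine ⟨hη0, (log_pos_iff hz0.le).1 (by linarith), hlogη, ?_, ?_⟩
  · refine (log_lt_log_iff hl2' (rpow_pos_of_pos hz0 _)).1 ?_
    rw [log_rpow hz0, ← hl3def]
    nlinarith
  · have h1 : exp 5 ≤ 2 / η := by
      have h2 : exp 5 = exp 1 ^ 5 := by rw [← exp_nat_mul]; norm_num
      have h3 : exp 1 ^ 5 ≤ 2.7182818286 ^ 5 := by gcongr; exact exp_one_lt_d9.le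
      rw [h2, le_div_iff₀ hη0]
      norm_num at h3
      nlinarith
    have := (le_log_iff_exp_le (by positivity)).2 h1
    linarith

/-- This makes `z^(1.2u)` at most `e^(0.12z)`, small against `x ≥ e^(3z)`. The fourth root of `z`
turns the claim into `40 log t ≤ t²`. -/
theorem mul_log_le_of_le_sqrt {z u : ℝ} (hz : 0 < z) (hlz : 100 ≤ log z) (huz : u ≤ √z) :
    u * log z ≤ z / 10 := by
  have h1 : √z * log z ≤ z / 10 := by
    set t := √(√z) with ht
    have ht0 : 0 < t := sqrt_pos.2 (sqrt_pos.2 hz)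
    have hs : √z = t ^ 2 := (sq_sqrt (sqrt_nonneg z)).symm
    have hzt : z = t ^ 4 := by rw [← sq_sqrt hz.le, hs]; ring
    have hlog : log z = 4 * log t := by rw [hzt, log_pow]; norm_num
    have hlt : log t ≤ t - 1 := log_le_sub_one_of_pos ht0
    have hlt25 : 25 ≤ log t := by linarith
    have ht40 : 40 ≤ t := by
      have h2 : exp 25 ≤ t := (le_log_iff_exp_le ht0).1 hlt25
      have h3 : (2 : ℝ) ^ 25 ≤ exp 25 := by
        have h4 : exp 25 = exp 1 ^ 25 := by rw [← exp_nat_mul]; norm_num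
        rw [h4]
        gcongr
        linarith [exp_one_gt_d9]
      norm_num at h3
      linarith
    rw [hs, hlog, hzt]
    have : 4 * log t ≤ t ^ 2 / 10 := by nlinarith
    calc t ^ 2 * (4 * log t) ≤ t ^ 2 * (t ^ 2 / 10) := by gcongr
      _ = _ := by ring
  exact (mul_le_mul_of_nonneg_right huz (by linarith)).trans h1

theorem log_ratio_le {z u η : ℝ} (hz : 0 < z) (hη : 0 < η) (hu : 0 < u) (huz : u ≤ √z)
    (hηz : log (2 / η) ≤ log z / 20) : log (2 * u / η ^ 2) ≤ 0.6 * log z := by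
  have h1 : log u ≤ log z / 2 := by
    rw [← log_sqrt hz.le]
    exact log_le_log hu huz
  rw [log_div two_ne_zero hη.ne'] at hηz
  rw [log_div (by positivity) (by positivity), log_mul two_ne_zero hu.ne', log_pow]
  have := log_pos (one_lt_two (α := ℝ))
  push_cast
  linarith

theorem exists_prime_between {y : ℝ} (hy : 1 ≤ y) :
    ∃ l : ℕ, l.Prime ∧ y < l ∧ (l : ℝ) ≤ 2 * y := by
  have hn : ⌊y⌋₊ ≠ 0 := (Nat.floor_pos.2 hy).ne'
  obtain ⟨l, hl, h1, h2⟩ := Nat.exists_prime_lt_and_le_two_mul _ hn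
  refine ⟨l, hl, (Nat.floor_lt (by linarith)).1 h1, ?_⟩
  calc (l : ℝ) ≤ 2 * (⌊y⌋₊ : ℝ) := by exact_mod_cast h2
    _ ≤ 2 * y := by
      have := Nat.floor_le (by linarith : 0 ≤ y)
      linarith

theorem le_exp_seven_and_half : 1024 ≤ exp 7.5 := by
  have h1 : exp 7.5 = exp 1 ^ 7 * exp 0.5 := by
    rw [← exp_nat_mul, ← exp_add]; norm_num
  have h2 : (1.5 : ℝ) ≤ exp 0.5 := by linarith [add_one_le_exp (0.5 : ℝ)]
  have h3 : (2.7 : ℝ) ^ 7 ≤ exp 1 ^ 7 := by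
    gcongr
    linarith [exp_one_gt_d9]
  rw [h1]
  calc (1024 : ℝ) ≤ 2.7 ^ 7 * 1.5 := by norm_num
    _ ≤ _ := by gcongr

/-- The errors `4/l` and the rounding `1` cost at most `E/256 + E/1024` of the deviation `E/8`,
leaving more than `E/16`. -/
theorem le_of_deviation {E D y N t : ℝ} (hy : 0 < y) (hN : N ≤ y) (ht0 : 0 ≤ t)
    (hE : 0 < E) (hD : 0 ≤ D) (ht : t ≤ E / 256) (hEy : 1 ≤ E / 1024 * y)
    (h : 1 / 8 * E * y < N * (t + D) + 1) : E / 16 ≤ D := by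
  have h1 : N * (t + D) ≤ y * (E / 256 + D) :=
    mul_le_mul hN (by linarith) (by linarith) hy.le
  have h2 : 0 < E * y := mul_pos hE hy
  refine le_of_mul_le_mul_left ?_ hy
  linarith

set_option maxHeartbeats 800000 in
theorem theorem2p4 :
    ∃ C : ℝ, 0 < C ∧ ∃ X : ℝ, ∀ x : ℝ, X ≤ x →
      ∀ a : ℕ → ℝ, (∀ n, 0 ≤ a n) → 0 < ArithSeq.total a x →
      ∀ S : Finset ℕ, (∀ p ∈ S, p.Prime ∧ (p : ℝ) ≤ Real.log (Real.log x)) →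
      ∀ h : ArithmeticFunction ℝ, h.IsMultiplicative → (∀ n, 0 ≤ h n ∧ h n ≤ 1) →
      ∀ η : ℝ, 20 * Real.log (Real.log (Real.log x)) / Real.log (Real.log x) ≤ η →
        η < 1 / 100 →
      ∀ z : ℝ, Real.log x ^ η ≤ z → z ≤ Real.log x / 3 →
        η * Real.log ((1 - η)⁻¹) ≤
          ∑ p ∈ (Finset.Icc ⌈z ^ (1 - η)⌉₊ ⌊z⌋₊).filter Nat.Prime, (1 - h p) / (p : ℝ) →
      ∀ u : ℝ, 5 / η ^ 2 ≤ u → u ≤ √z →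
        ∃ ℓ : ℕ, 1 ≤ ℓ ∧ (ℓ : ℝ) ≤ x / z ^ u ∧ (∀ p ∈ S, ¬ p ∣ ℓ) ∧
          C * Real.exp (-u * (1 + 25 * η) * Real.log (2 * u / η ^ 2)) ≤
            ArithSeq.Delta a h x ℓ := by
  -- `C` must satisfy `(480 + 32) C < 1/16`. The threshold gives `log log log x ≥ 1`.
  refine ⟨1 / 10000, by norm_num, exp (exp (exp 1)), ?_⟩
  intro x hx a ha hA S hS h hmul hh η hη hη1 z hz1 hz2 hsum u hu huz
  obtain ⟨hη0, hz, hηz, hSz, hL⟩ := parameter_bounds hx hη hη1 hz1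
  have h0 : ∀ n, 0 ≤ h n := fun n => (hh n).1
  have hle : ∀ n, h n ≤ 1 := fun n => (hh n).2
  have hx0 : 0 < x := (exp_pos _).trans_le hx
  have hz0 : 0 < z := by linarith
  have hu0 : 50000 ≤ u := by
    refine le_trans ?_ hu
    rw [le_div_iff₀ (by positivity)]
    nlinarith
  set L := log z with hLdef
  set P := primesIn (z ^ (1 - η)) z with hPdef
  set g := ArithSeq.defect h with hg
  have hP : ∀ p ∈ P, p.Prime := fun p hp => (mem_primesIn hp).1
  have hgb : ∀ p ∈ P, 0 ≤ g p ∧ 1 - h p ≤ g p ∧ g p ≤ 1 := fun p hp =>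
    ArithSeq.defect_bounds h0 hle (hP p hp)
  have hw : log (z ^ (1 - η)) = (1 - η) * L := log_rpow hz0 _
  have hrec : ∑ p ∈ P, 1 / (p : ℝ) ≤ 2 := by
    refine (sum_inv_primesIn_le (one_lt_rpow hz (by linarith)) hz.le).trans ?_
    rw [hw, div_le_iff₀ (by nlinarith)]
    have : log 4 ≤ 3 := (log_le_sub_one_of_pos (by norm_num)).trans (by norm_num)
    nlinarith
  have hB2 : ∑ p ∈ P, g p / p ≤ 2 := by
    refine le_trans (sum_le_sum fun p hp => ?_) hrec
    have := (hgb p hp).2.2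
    gcongr
  have hB : η ^ 2 ≤ ∑ p ∈ P, g p / p := by
    have h1 : η ≤ log ((1 - η)⁻¹) := by
      rw [log_inv]
      linarith [log_le_sub_one_of_pos (by linarith : 0 < 1 - η)]
    calc η ^ 2 = η * η := sq η
      _ ≤ η * log ((1 - η)⁻¹) := by gcongr
      _ ≤ ∑ p ∈ P, (1 - h p) / (p : ℝ) := hsum
      _ ≤ _ := by
        refine sum_le_sum fun p hp => ?_
        have := (hgb p hp).2.1
        gcongr
  obtain ⟨y, hy1, hy2, hy3⟩ := exists_abs_fractSum_gt (P := P) (g := g)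
    (fun p hp => (hP p hp).pos) (fun p hp => (hgb p hp).1) (fun p hp => (hgb p hp).2.2) hz hη0 hη1
    (fun p hp => (mem_primesIn hp).2.1) (fun p hp => (mem_primesIn hp).2.2) hB hB2 hηz hu huz
  have huL : u * L ≤ z / 10 := mul_log_le_of_le_sqrt hz0 hL huz
  have hY := log_ratio_le hz0 hη0 (by linarith) huz hηz
  set Y := u * (1 + 25 * η) * log (2 * u / η ^ 2) with hYdef
  have hYle : Y ≤ 0.75 * (u * L) := by
    calc Y ≤ u * (1 + 25 * η) * (0.6 * L) := by rw [hYdef]; gcongr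
      _ ≤ u * 1.25 * (0.6 * L) := by gcongr; linarith
      _ = _ := by ring
  have hzu : z ^ u = exp (u * L) := by rw [rpow_def_of_pos hz0, mul_comm]
  have hzV : z ^ (1.2 * u) = exp (1.2 * (u * L)) := by
    rw [rpow_def_of_pos hz0, ← hLdef]
    ring_nf
  rw [hzu] at hy1
  rw [hzV] at hy2
  have huL7 : 1000 ≤ u * L := by nlinarith
  have hlogx : exp (3 * z) ≤ x := by
    rw [← exp_log hx0]
    exact exp_le_exp.2 (by linarith)
  have hy0 : 0 < y := (exp_pos _).trans_le hy1
  have hy4 : 4 ≤ y := by linarith [add_one_le_exp (u * L)]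
  set N := ⌊y⌋₊ with hN
  have hN1 : (N : ℝ) ≤ y := Nat.floor_le hy0.le
  have hN2 : y < N + 1 := Nat.lt_floor_add_one y
  have hN0 : (0 : ℝ) < N := by linarith
  have hz1000 : 1000 ≤ z := by linarith
  have hxN : exp (2.8 * z) * N ≤ x := by
    calc exp (2.8 * z) * N ≤ exp (2.8 * z) * exp (1.2 * (u * L)) := by gcongr; linarith
      _ = exp (2.8 * z + 1.2 * (u * L)) := (exp_add _ _).symm
      _ ≤ exp (3 * z) := exp_le_exp.2 (by linarith)
      _ ≤ x := hlogx
  have hx8N : exp (2.7 * z) ≤ x / (8 * N) := by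
    rw [le_div_iff₀ (by linarith)]
    have h8 : 8 ≤ exp (0.1 * z) := by linarith [add_one_le_exp (0.1 * z)]
    calc exp (2.7 * z) * (8 * N) ≤ exp (2.7 * z) * (exp (0.1 * z) * N) := by gcongr
      _ = exp (2.7 * z) * exp (0.1 * z) * N := by ring
      _ = exp (2.8 * z) * N := by rw [← exp_add]; ring_nf
      _ ≤ x := hxN
  -- Bertrand's postulate places `l` in `(x/(8N), x/(4N)]`, so the row length `lN` is comparable to
  -- `x`, and `l` far exceeds `z`.
  obtain ⟨l, hl, hl1, hl2⟩ := exists_prime_between ((one_le_exp (by linarith)).trans hx8N)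
  have hl3 : exp (2.7 * z) ≤ l := hx8N.trans hl1.le
  have hlz : z < l := by linarith [add_one_le_exp (2.7 * z)]
  have hl0 : (0 : ℝ) < l := hz0.trans hlz
  have hlP : l ∉ P := fun hlP => absurd (mem_primesIn hlP).2.2 (not_le.2 hlz)
  have hlN1 : x / 8 ≤ (l : ℝ) * N := by
    rw [div_lt_iff₀ (by linarith)] at hl1
    linarith
  have hlN2 : (l : ℝ) * N ≤ x / 4 := by
    have : 2 * (x / (8 * N)) = x / 4 / N := by field_simp; norm_num
    rwa [this, le_div_iff₀ hN0] at hl2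
  set q := ∏ p ∈ P, p with hq
  have hq4 : (q : ℝ) ≤ exp (1.5 * z) := by
    refine (prod_primesIn_le hz0.le).trans (exp_le_exp.2 ?_)
    have : log 4 ≤ 1.5 := by
      have h4 : (4 : ℝ) = 2 ^ 2 := by norm_num
      rw [h4, log_pow]
      push_cast
      linarith [log_two_lt_d9]
    gcongr
  have hqx : 8 * (q : ℝ) ≤ x := by
    have h8 : 8 ≤ exp (1.5 * z) := by linarith [add_one_le_exp (1.5 * z)]
    calc 8 * (q : ℝ) ≤ exp (1.5 * z) * exp (1.5 * z) := by gcongr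
      _ = exp (3 * z) := by rw [← exp_add]; ring_nf
      _ ≤ x := hlogx
  have hmain := ArithSeq.abs_fractSum_le_Delta ha hmul.1 h0 hle hx0 hA hP hrec hl hlP
    (Nat.cast_pos.1 hN0) hlN2 hlN1 hqx
  have hfloor := abs_fractSum_floor_sub_le h0 hle hP hy0.le
  set Dq := ArithSeq.Delta a h x q with hDq
  set Dl := ArithSeq.Delta a h x l with hDl
  have hE : exp (-u * (1 + 25 * η) * log (2 * u / η ^ 2)) = exp (-Y) := by
    rw [hYdef]
    ring_nf
  rw [hE]
  set E := exp (-Y) with hEdef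
  -- `E` is at least `z^(-0.75u)`, so both `y ≥ z^u` and `l ≥ e^(2.7z)` dominate `1/E`.
  have hsmall : ∀ t : ℝ, 0.75 * (u * L) + 7.5 ≤ t → 1 ≤ E / 1024 * exp t := fun t ht => by
    have h1 : exp 7.5 ≤ E * exp t := by
      rw [hEdef, ← exp_add]
      exact exp_le_exp.2 (by linarith)
    linarith [le_exp_seven_and_half]
  have hy5 : 1 ≤ E / 1024 * y := by
    refine (hsmall (u * L) (by linarith)).trans ?_
    gcongr
  have hl5 : 4 / (l : ℝ) ≤ E / 256 := by
    rw [div_le_iff₀ hl0]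
    have h1 := hsmall (2.7 * z) (by linarith)
    have h2 : E / 1024 * exp (2.7 * z) ≤ E / 1024 * l := by gcongr
    linarith
  have hdelta : E / 16 ≤ 480 * Dq + 32 * Dl := by
    have hDq0 : 0 ≤ Dq := ArithSeq.Delta_nonneg h hA q
    have hDl0 : 0 ≤ Dl := ArithSeq.Delta_nonneg h hA l
    exact le_of_deviation hy0 hN1 (by positivity) (exp_pos _) (by positivity) hl5 hy5
      (hy3.trans_le (hfloor.trans (by linarith)))
  rcases le_or_gt (1 / 10000 * E) Dq with hcase | hcase
  · refine ⟨q, prod_pos fun p hp => (hP p hp).pos, ?_, fun p hp hpq => ?_, hcase⟩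
    · rw [hzu, le_div_iff₀ (exp_pos _)]
      calc (q : ℝ) * exp (u * L) ≤ exp (1.5 * z) * exp (u * L) := by gcongr
        _ = exp (1.5 * z + u * L) := (exp_add _ _).symm
        _ ≤ exp (3 * z) := exp_le_exp.2 (by linarith)
        _ ≤ x := hlogx
    -- Primes of `S` are at most `log log x < z^(1-η)`, below every prime factor of `q`.
    · obtain ⟨r, hr, hpr⟩ := ((hS p hp).1.prime.dvd_finsetProd_iff _).1 hpq
      have hpr' := (Nat.prime_dvd_prime_iff_eq (hS p hp).1 (hP r hr)).1 hpr
      have h1 := (mem_primesIn hr).2.1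
      have h2 := (hS p hp).2
      rw [hpr'] at h2
      linarith
  · refine ⟨l, hl.one_le, ?_, fun p hp hpl => ?_, ?_⟩
    · rw [hzu, le_div_iff₀ (exp_pos _)]
      -- `z^u ≤ y < N + 1 ≤ 4N`, and `4lN ≤ x` by the choice of `l`.
      calc (l : ℝ) * exp (u * L) ≤ l * (4 * N) := by gcongr; linarith
        _ ≤ x := by linarith
    · have hpr' := (Nat.prime_dvd_prime_iff_eq (hS p hp).1 hl).1 hpl
      have h2 := (hS p hp).2
      have h3 : z ^ (1 - η) ≤ z := by
        calc z ^ (1 - η) ≤ z ^ (1 : ℝ) := rpow_le_rpow_of_exponent_le hz.le (by linarith)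
          _ = z := rpow_one z
      rw [hpr'] at h2
      linarith
    · have hE0 : 0 < E := exp_pos _
      linarith
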